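/- Let $L$ be a fixed separable infinite-dimensional complex Hilbert space, $\mathcal B=\mathcal B(L)$ and $\mathcal K=\mathcal K(L)$ the algebras of bounded and of compact operators on $L$, and $\iota:L\to L\mathbin{\dot\otimes}L$ a fixed unitary isomorphism onto the Hilbert tensor square; put $a\diamond b:=\iota^*(a\mathbin{\dot\otimes}b)\iota$ for $a,b\in\mathcal B$. For a complex linear space $E$ write $\mathcal KE:=\mathcal K\otimes E$ (algebraic tensor product, with elementary tensors written $ax$); it is a $\mathcal B$-bimodule via $a\cdot bx=(ab)x$, $bx\cdot a=(ba)x$. A projection $P\in\mathcal B$ is a support of $u\in\mathcal KE$ if $P\cdot u=u=u\cdot P$. A quantum norm on $E$ is a norm on $\mathcal KE$ such that $\|a\cdot u\|,\|u\cdot a\|\le\|a\|\,\|u\|$ for $a\in\mathcal B$, $u\in\mathcal KE$, and $\|u+v\|=\max\{\|u\|,\|v\|\}$ whenever $u$ and $v$ have supports $P$ and $Q$ with $PQ=0$; a quantum space is a linear space with a quantum norm. A linear map $\varphi:E\to G$ of quantum spaces is completely bounded (completely contractive) if $\varphi_\infty:=\mathbf 1_{\mathcal K}\otimes\varphi:\mathcal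 KE\to\mathcal KG$ is bounded (contractive), and $\|\varphi\|_{cb}:=\|\varphi_\infty\|$. A bilinear map $\mathcal R:E\times F\to G$ of quantum spaces is weakly completely bounded (weakly completely contractive) if the bilinear map $\mathcal R_w:\mathcal KE\times\mathcal KF\to\mathcal KG$ determined by $\mathcal R_w(ax,by)=(a\diamond b)\mathcal R(x,y)$ is bounded (contractive), and $\|\mathcal R\|_{wcb}:=\|\mathcal R_w\|$. Let $E$ and $F$ be quantum spaces, let $\vartheta:E\times F\to E\otimes F$, $\vartheta(x,y)=x\otimes y$, and write $u\diamond v:=\vartheta_w(u,v)$. Then the following holds. (i) The linear operator $\mathcal K\otimes\mathcal KE\otimes\mathcal KF\otimes\mathcal K\to\mathcal K(E\otimes F)$ with $b\otimes u\otimes v\otimes d\mapsto b\cdot(u\diamond v)\cdot d$ is surjective. Let $\|\cdot\|_4$ be the quotient under this operator of the projective norm on $\mathcal K\otimes\mathcal KE\otimes\mathcal KF\otimes\mathcal K$. Then $$\|U\|_4=\inf\Big\{\sum_{k=1}^n\|b_k\|\,\|u_k\|\,\|v_k\|\,\|d_k\| \;:\; U=\sum_{k=1}^n b_k\cdot(u_k\diamond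 v_k)\cdot d_k\Big\}\qquad(U\in\mathcal K(E\otimes F)),$$ where $b_k,d_k\in\mathcal K$, $u_k\in\mathcal KE$, $v_k\in\mathcal KF$. (ii) $\|\cdot\|_4$ is a quantum norm on $E\otimes F$. Denote the resulting quantum space by $E\otimes_4F$. (iii) For every quantum space $G$ and every weakly completely bounded bilinear $\mathcal R:E\times F\to G$ there is a unique completely bounded linear $R:E\otimes_4F\to G$ with $R(x\otimes y)=\mathcal R(x,y)$ for all $x\in E$, $y\in F$; moreover $\|R\|_{cb}=\|\mathcal R\|_{wcb}$. (iv) $(E\otimes_4F,\vartheta)$ is the four-named (operator-projective) tensor product of $E$ and $F$: $\vartheta$ is weakly completely contractive, and for every quantum space $G$ and every weakly completely contractive bilinear $\mathcal R:E\times F\to G$ there is a unique completely contractive linear $R:E\otimes_4F\to G$ with $R\circ\vartheta=\mathcal R$. -/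

import Mathlib

open scoped TensorProduct

universe u v₁ v₂ v₃ w

noncomputable section

namespace QuantumTensor

/-! ### Hilbert tensor products -/

section Hilbert

variable (H K : Type*) [NormedAddCommGroup H] [InnerProductSpace ℂ H]
  [NormedAddCommGroup K] [InnerProductSpace ℂ K]

/-- The Hilbert tensor product of two Hilbert spaces: the completion of the algebraic tensor
product with respect to the inner product `⟪x ⊗ y, x' ⊗ y'⟫ = ⟪x, x'⟫ ⟪y, y'⟫`. -/
def HilbertTensor : Type _ := UniformSpace.Completion (H ⊗[ℂ] K)

instance : NormedAddCommGroup (HilbertTensor H K) :=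
  inferInstanceAs (NormedAddCommGroup (UniformSpace.Completion (H ⊗[ℂ] K)))

instance : InnerProductSpace ℂ (HilbertTensor H K) :=
  inferInstanceAs (InnerProductSpace ℂ (UniformSpace.Completion (H ⊗[ℂ] K)))

instance : CompleteSpace (HilbertTensor H K) :=
  inferInstanceAs (CompleteSpace (UniformSpace.Completion (H ⊗[ℂ] K)))

/-- The canonical isometric embedding of the algebraic tensor product. -/
def hilbertIncl : H ⊗[ℂ] K →ₗᵢ[ℂ] HilbertTensor H K :=
  (UniformSpace.Completion.toComplₗᵢ : H ⊗[ℂ] K →ₗᵢ[ℂ] UniformSpace.Completion (H ⊗[ℂ] K))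

theorem denseRange_hilbertIncl : DenseRange (hilbertIncl H K) :=
  UniformSpace.Completion.denseRange_coe

variable {H K}
variable {H' K' : Type*} [NormedAddCommGroup H'] [InnerProductSpace ℂ H']
  [NormedAddCommGroup K'] [InnerProductSpace ℂ K']

/-- The Hilbert tensor product of two bounded operators, `ξ ⊗ η ↦ a ξ ⊗ b η`: the continuous
extension to the completion of the algebraic tensor product of the operators. -/
def hilbertMap (a : H →L[ℂ] H') (b : K →L[ℂ] K') : HilbertTensor H K →L[ℂ] HilbertTensor H' K' :=
  ((hilbertIncl H' K').toContinuousLinearMap ∘L TensorProduct.mapL a b).extend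
    (hilbertIncl H K).toContinuousLinearMap

theorem hilbertMap_incl (a : H →L[ℂ] H') (b : K →L[ℂ] K') (z : H ⊗[ℂ] K) :
    hilbertMap a b (hilbertIncl H K z) = hilbertIncl H' K' (TensorProduct.mapL a b z) :=
  ContinuousLinearMap.extend_eq _ (denseRange_hilbertIncl H K)
    (hilbertIncl H K).isometry.isUniformInducing z

theorem hilbertMap_tmul (a : H →L[ℂ] H') (b : K →L[ℂ] K') (x : H) (y : K) :
    hilbertMap a b (hilbertIncl H K (x ⊗ₜ[ℂ] y)) = hilbertIncl H' K' (a x ⊗ₜ[ℂ] b y) :=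
  hilbertMap_incl a b _

theorem hilbertMap_ext {T S : HilbertTensor H K →L[ℂ] HilbertTensor H' K'}
    (h : ∀ z : H ⊗[ℂ] K, T (hilbertIncl H K z) = S (hilbertIncl H K z)) : T = S :=
  ContinuousLinearMap.coeFn_injective
    ((denseRange_hilbertIncl H K).equalizer T.continuous S.continuous (funext h))

theorem hilbertMap_add_left (a a' : H →L[ℂ] H') (b : K →L[ℂ] K') :
    hilbertMap (a + a') b = hilbertMap a b + hilbertMap a' b := by
  apply hilbertMap_ext
  intro z
  simp only [hilbertMap_incl, TensorProduct.mapL_add_left, add_apply,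
    map_add]

theorem hilbertMap_add_right (a : H →L[ℂ] H') (b b' : K →L[ℂ] K') :
    hilbertMap a (b + b') = hilbertMap a b + hilbertMap a b' := by
  apply hilbertMap_ext
  intro z
  simp only [hilbertMap_incl, TensorProduct.mapL_add_right, add_apply,
    map_add]

theorem hilbertMap_smul_left (c : ℂ) (a : H →L[ℂ] H') (b : K →L[ℂ] K') :
    hilbertMap (c • a) b = c • hilbertMap a b := by
  apply hilbertMap_ext
  intro z
  simp only [hilbertMap_incl, TensorProduct.mapL_smul_left, smul_apply,
    map_smul]

theorem hilbertMap_smul_right (c : ℂ) (a : H →L[ℂ] H') (b : K →L[ℂ] K') :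
    hilbertMap a (c • b) = c • hilbertMap a b := by
  apply hilbertMap_ext
  intro z
  simp only [hilbertMap_incl, TensorProduct.mapL_smul_right, smul_apply,
    map_smul]

theorem norm_hilbertMap_le (a : H →L[ℂ] H') (b : K →L[ℂ] K') :
    ‖hilbertMap a b‖ ≤ ‖a‖ * ‖b‖ := by
  refine ContinuousLinearMap.opNorm_le_bound _ (by positivity) fun x => ?_
  induction x using (denseRange_hilbertIncl H K).induction_on with
  | hp => exact isClosed_le (hilbertMap a b).continuous.norm (continuous_const.mul continuous_norm)
  | ih z =>
    rw [hilbertMap_incl, LinearIsometry.norm_map, LinearIsometry.norm_map]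
    exact ((TensorProduct.mapL a b).le_opNorm z).trans
      (mul_le_mul_of_nonneg_right (TensorProduct.norm_mapL_le a b) (norm_nonneg _))

/-- A compact operator into a Hilbert space is a limit of finite rank operators. -/
theorem exists_finiteRank_near {a : H →L[ℂ] H'} (ha : IsCompactOperator a) {ε : ℝ} (hε : 0 < ε) :
    ∃ c : H →L[ℂ] H', FiniteDimensional ℂ c.range ∧ ‖a - c‖ ≤ ε := by
  have hc := IsCompactOperator.isCompact_closure_image_closedBall (f := (a : H →ₗ[ℂ] H')) ha 1
  obtain ⟨t, ht, hcov⟩ := Metric.totallyBounded_iff.1 hc.totallyBounded ε hε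
  let S : Submodule ℂ H' := Submodule.span ℂ t
  have : FiniteDimensional ℂ S := FiniteDimensional.span_of_finite ℂ ht
  refine ⟨S.starProjection ∘L a, ?_, ?_⟩
  · have : (S.starProjection ∘L a).range ≤ S := by
      rintro _ ⟨x, rfl⟩
      simp
    exact Submodule.finiteDimensional_of_le this
  · refine ContinuousLinearMap.opNorm_le_of_unit_norm hε.le fun x hx => ?_
    have hmem : a x ∈ closure ((a : H →ₗ[ℂ] H') '' Metric.closedBall 0 1) :=
      subset_closure ⟨x, by simp [hx], rfl⟩
    obtain ⟨y, hy, hxy⟩ := Set.mem_iUnion₂.1 (hcov hmem)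
    have h1 : ‖a x - S.starProjection (a x)‖ ≤ ‖a x - y‖ := by
      rw [Submodule.starProjection_minimal]
      exact ciInf_le ⟨0, by rintro _ ⟨w, rfl⟩; exact norm_nonneg _⟩
        (⟨y, Submodule.subset_span hy⟩ : S)
    rw [Metric.mem_ball, dist_eq_norm] at hxy
    exact h1.trans hxy.le

theorem isCompactOperator_of_finiteRange {T : H →L[ℂ] K} (W : Submodule ℂ K)
    [FiniteDimensional ℂ W] (hT : ∀ x, T x ∈ W) : IsCompactOperator T := by
  have : ProperSpace W := FiniteDimensional.proper ℂ W
  have h : IsCompactOperator (T.codRestrict W hT) :=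
    isCompactOperator_of_locallyCompactSpace_dom (T.codRestrict W hT)
  exact h.clm_comp W.subtypeL

theorem isCompactOperator_hilbertMap_of_finiteRank (c : H →L[ℂ] H') (d : K →L[ℂ] K')
    [FiniteDimensional ℂ c.range] [FiniteDimensional ℂ d.range] :
    IsCompactOperator (hilbertMap c d) := by
  let φ : (c.range ⊗[ℂ] d.range) →ₗ[ℂ] HilbertTensor H' K' :=
    (hilbertIncl H' K').toLinearMap ∘ₗ
      TensorProduct.map c.range.subtype d.range.subtype
  have hmem : ∀ x, hilbertMap c d x ∈ φ.range := by
    intro x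
    induction x using (denseRange_hilbertIncl H K).induction_on with
    | hp =>
      exact (Submodule.closed_of_finiteDimensional φ.range).preimage (hilbertMap c d).continuous
    | ih z =>
      induction z using TensorProduct.induction_on with
      | zero =>
        rw [map_zero, map_zero]
        exact zero_mem _
      | tmul x y =>
        refine ⟨⟨c x, x, rfl⟩ ⊗ₜ ⟨d y, y, rfl⟩, ?_⟩
        rw [hilbertMap_incl]
        rfl
      | add z w hz hw =>
        rw [map_add, map_add]
        exact add_mem hz hw
  exact isCompactOperator_of_finiteRange φ.range hmem

/-- The Hilbert tensor product of two compact operators is compact. -/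
theorem isCompactOperator_hilbertMap {a : H →L[ℂ] H'} {b : K →L[ℂ] K'}
    (ha : IsCompactOperator a) (hb : IsCompactOperator b) :
    IsCompactOperator (hilbertMap a b) := by
  have hcl : IsClosed {T : HilbertTensor H K →L[ℂ] HilbertTensor H' K' | IsCompactOperator T} :=
    isClosed_setOfPred_isCompactOperator
  refine hcl.closure_subset ((Metric.mem_closure_iff
    (α := HilbertTensor H K →L[ℂ] HilbertTensor H' K')).2 fun ε hε => ?_)
  obtain ⟨δ, hδ, hδ1, hδε⟩ : ∃ δ : ℝ, 0 < δ ∧ δ ≤ 1 ∧ δ * (‖a‖ + ‖b‖ + 1) < ε := by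
    refine ⟨min 1 (ε / (2 * (‖a‖ + ‖b‖ + 1))), by positivity, min_le_left _ _, ?_⟩
    have hpos : 0 < ‖a‖ + ‖b‖ + 1 := by positivity
    calc _ ≤ ε / (2 * (‖a‖ + ‖b‖ + 1)) * (‖a‖ + ‖b‖ + 1) :=
          mul_le_mul_of_nonneg_right (min_le_right _ _) hpos.le
      _ = ε / 2 := by field_simp
      _ < ε := by linarith
  obtain ⟨c, hc, hac⟩ := exists_finiteRank_near ha hδ
  obtain ⟨d, hd, hbd⟩ := exists_finiteRank_near hb hδ
  refine ⟨hilbertMap c d, isCompactOperator_hilbertMap_of_finiteRank c d, ?_⟩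
  have hsplit : hilbertMap a b - hilbertMap c d =
      hilbertMap (a - c) b + hilbertMap c (b - d) := by
    have h1 := hilbertMap_add_left (a - c) c b
    have h2 := hilbertMap_add_right c (b - d) d
    rw [sub_add_cancel] at h1 h2
    rw [h1, h2]
    abel
  have hcn : ‖c‖ ≤ ‖a‖ + 1 := by
    have := norm_sub_norm_le c a
    rw [norm_sub_rev] at this
    linarith
  refine lt_of_eq_of_lt (dist_eq_norm (hilbertMap a b) (hilbertMap c d)) ?_
  rw [hsplit]
  calc _ ≤ ‖a - c‖ * ‖b‖ + ‖c‖ * ‖b - d‖ :=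
        (norm_add_le _ _).trans (add_le_add (norm_hilbertMap_le _ _) (norm_hilbertMap_le _ _))
    _ ≤ δ * ‖b‖ + (‖a‖ + 1) * δ := by gcongr
    _ = δ * (‖a‖ + ‖b‖ + 1) := by ring
    _ < ε := hδε

end Hilbert

/-! ### The coefficient algebras and the diamond operation -/

section Coefficients

variable (L : Type*) [NormedAddCommGroup L] [InnerProductSpace ℂ L]

/-- The space `𝒦` of compact operators on `L`, with the operator norm. -/
abbrev Cpt : Submodule ℂ (L →L[ℂ] L) := compactOperator (RingHom.id ℂ) L L

variable {L}

/-- Left multiplication `𝓑 × 𝒦 → 𝒦`, `(a, b) ↦ a b`. -/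
def cptMulLeft : (L →L[ℂ] L) →ₗ[ℂ] Cpt L →ₗ[ℂ] Cpt L :=
  LinearMap.mk₂ ℂ (fun a b => ⟨a * (b : L →L[ℂ] L), IsCompactOperator.clm_comp b.2 a⟩)
    (fun _ _ _ => Subtype.ext (add_mul _ _ _)) (fun _ _ _ => Subtype.ext (smul_mul_assoc _ _ _))
    (fun _ _ _ => Subtype.ext (mul_add _ _ _)) (fun _ _ _ => Subtype.ext (mul_smul_comm _ _ _))

/-- Right multiplication `(a, b) ↦ b a`, for `a` in `𝓑` and `b` in `𝒦`. -/
def cptMulRight : (L →L[ℂ] L) →ₗ[ℂ] Cpt L →ₗ[ℂ] Cpt L :=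
  LinearMap.mk₂ ℂ (fun a b => ⟨(b : L →L[ℂ] L) * a, IsCompactOperator.comp_clm b.2 a⟩)
    (fun _ _ _ => Subtype.ext (mul_add _ _ _)) (fun _ _ _ => Subtype.ext (mul_smul_comm _ _ _))
    (fun _ _ _ => Subtype.ext (add_mul _ _ _)) (fun _ _ _ => Subtype.ext (smul_mul_assoc _ _ _))

/-- The operation `a ⋄ b = ι* (a ⊗ b) ι` on bounded operators, for a unitary `ι : L → L ⊗ L`
(so that `ι* = ι⁻¹`), where `⊗` is the Hilbert tensor product. -/
def diamond (ι : L ≃ₗᵢ[ℂ] HilbertTensor L L) (a b : L →L[ℂ] L) : L →L[ℂ] L :=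
  (ι.symm.toContinuousLinearEquiv : HilbertTensor L L →L[ℂ] L) ∘L hilbertMap a b ∘L
    (ι.toContinuousLinearEquiv : L →L[ℂ] HilbertTensor L L)

theorem diamond_apply (ι : L ≃ₗᵢ[ℂ] HilbertTensor L L) (a b : L →L[ℂ] L) (x : L) :
    diamond ι a b x = ι.symm (hilbertMap a b (ι x)) := rfl

theorem isCompactOperator_diamond (ι : L ≃ₗᵢ[ℂ] HilbertTensor L L) (a b : Cpt L) :
    IsCompactOperator (diamond ι (a : L →L[ℂ] L) (b : L →L[ℂ] L)) :=
  ((isCompactOperator_hilbertMap a.2 b.2).comp_clm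
    (ι.toContinuousLinearEquiv : L →L[ℂ] HilbertTensor L L)).clm_comp
    (ι.symm.toContinuousLinearEquiv : HilbertTensor L L →L[ℂ] L)

/-- The operation `⋄` as a bilinear map `𝒦 × 𝒦 → 𝒦`. -/
def cptDiamond (ι : L ≃ₗᵢ[ℂ] HilbertTensor L L) : Cpt L →ₗ[ℂ] Cpt L →ₗ[ℂ] Cpt L :=
  LinearMap.mk₂ ℂ (fun a b => ⟨diamond ι a b, isCompactOperator_diamond ι a b⟩)
    (fun a a' b => Subtype.ext (ContinuousLinearMap.ext fun x => by
      simp [diamond_apply, hilbertMap_add_left]))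
    (fun c a b => Subtype.ext (ContinuousLinearMap.ext fun x => by
      simp [diamond_apply, hilbertMap_smul_left]))
    (fun a b b' => Subtype.ext (ContinuousLinearMap.ext fun x => by
      simp [diamond_apply, hilbertMap_add_right]))
    (fun c a b => Subtype.ext (ContinuousLinearMap.ext fun x => by
      simp [diamond_apply, hilbertMap_smul_right]))

end Coefficients

/-! ### Amplifications and quantum norms -/

section Quantum

variable (L : Type*) [NormedAddCommGroup L] [InnerProductSpace ℂ L]
variable (E : Type*) [AddCommGroup E] [Module ℂ E]

/-- The amplification `𝒦E = 𝒦 ⊗ E` (algebraic tensor product). -/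
abbrev Ampl : Type _ := Cpt L ⊗[ℂ] E

/-- A shortcut instance (Mathlib's additive group structure on a tensor product). -/
instance instAddCommGroupAmpl : AddCommGroup (Cpt L ⊗[ℂ] E) := TensorProduct.addCommGroup

variable {L E}

/-- The left outer multiplication `a · (b x) = (a b) x` of `𝓑` on `𝒦E`. -/
def lact : (L →L[ℂ] L) →ₗ[ℂ] Ampl L E →ₗ[ℂ] Ampl L E :=
  LinearMap.rTensorHom E ∘ₗ cptMulLeft

/-- The right outer multiplication of `𝓑` on `𝒦E`: `ract a (b x) = (b x) · a = (b a) x`. -/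
def ract : (L →L[ℂ] L) →ₗ[ℂ] Ampl L E →ₗ[ℂ] Ampl L E :=
  LinearMap.rTensorHom E ∘ₗ cptMulRight

theorem lact_tmul (a : L →L[ℂ] L) (b : Cpt L) (x : E) :
    lact a (b ⊗ₜ[ℂ] x : Ampl L E) = cptMulLeft a b ⊗ₜ[ℂ] x := rfl

theorem ract_tmul (a : L →L[ℂ] L) (b : Cpt L) (x : E) :
    ract a (b ⊗ₜ[ℂ] x : Ampl L E) = cptMulRight a b ⊗ₜ[ℂ] x := rfl

/-- The projection `P` is a (two-sided) support of `u`. -/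
def IsSupport [CompleteSpace L] (P : L →L[ℂ] L) (u : Ampl L E) : Prop :=
  IsStarProjection P ∧ lact P u = u ∧ ract P u = u

/-- The first axiom of Ruan for a seminorm on `𝒦E`. -/
def RuanOne (p : Seminorm ℂ (Ampl L E)) : Prop :=
  ∀ (a : L →L[ℂ] L) (u : Ampl L E), p (lact a u) ≤ ‖a‖ * p u ∧ p (ract a u) ≤ ‖a‖ * p u

/-- The second axiom of Ruan for a seminorm on `𝒦E`. -/
def RuanTwo [CompleteSpace L] (p : Seminorm ℂ (Ampl L E)) : Prop :=
  ∀ (P Q : L →L[ℂ] L) (u v : Ampl L E), IsSupport P u → IsSupport Q v → P * Q = 0 →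
    p (u + v) = max (p u) (p v)

variable (L E)

/-- A quantum norm on the linear space `E`: a norm on `𝒦E` satisfying both axioms of Ruan. -/
structure QuantumNorm [CompleteSpace L] where
  /-- the norm on `𝒦E` -/
  norm : Seminorm ℂ (Ampl L E)
  eq_zero_of_norm_eq_zero : ∀ u, norm u = 0 → u = 0
  ruanOne : RuanOne norm
  ruanTwo : RuanTwo norm

variable {L E}

/-- The amplification `φ_∞ = 1 ⊗ φ : 𝒦E → 𝒦F` of a linear operator. -/
def amplify (L : Type*) [NormedAddCommGroup L] [InnerProductSpace ℂ L]
    {E F : Type*} [AddCommGroup E] [Module ℂ E] [AddCommGroup F] [Module ℂ F]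
    (φ : E →ₗ[ℂ] F) : Ampl L E →ₗ[ℂ] Ampl L F :=
  LinearMap.lTensor (Cpt L) φ

variable {F : Type*} [AddCommGroup F] [Module ℂ F] {G : Type*} [AddCommGroup G] [Module ℂ G]

section Operators

variable [CompleteSpace L]

/-- Complete boundedness of a linear operator between quantum spaces. -/
def IsCompletelyBounded (nE : QuantumNorm L E) (nF : QuantumNorm L F) (φ : E →ₗ[ℂ] F) : Prop :=
  ∃ C : ℝ, ∀ u : Ampl L E, nF.norm (amplify L φ u) ≤ C * nE.norm u

/-- The completely bounded norm of a linear operator: the operator norm of `φ_∞`. -/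
def cbNorm (nE : QuantumNorm L E) (nF : QuantumNorm L F) (φ : E →ₗ[ℂ] F) : ℝ :=
  sInf {C : ℝ | 0 ≤ C ∧ ∀ u : Ampl L E, nF.norm (amplify L φ u) ≤ C * nE.norm u}

/-- Complete contractivity of a linear operator between quantum spaces. -/
def IsCompletelyContractive (nE : QuantumNorm L E) (nF : QuantumNorm L F)
    (φ : E →ₗ[ℂ] F) : Prop :=
  ∀ u : Ampl L E, nF.norm (amplify L φ u) ≤ nE.norm u

end Operators

/-- The weak amplification `(a x, b y) ↦ (a ⋄ b) R(x, y)` of a bilinear operator. -/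
def weakAmplify (ι : L ≃ₗᵢ[ℂ] HilbertTensor L L) (R : E →ₗ[ℂ] F →ₗ[ℂ] G) :
    Ampl L E →ₗ[ℂ] Ampl L F →ₗ[ℂ] Ampl L G :=
  TensorProduct.map₂ (cptDiamond ι) R

theorem weakAmplify_tmul (ι : L ≃ₗᵢ[ℂ] HilbertTensor L L) (R : E →ₗ[ℂ] F →ₗ[ℂ] G)
    (a b : Cpt L) (x : E) (y : F) :
    weakAmplify ι R (a ⊗ₜ[ℂ] x) (b ⊗ₜ[ℂ] y) = cptDiamond ι a b ⊗ₜ[ℂ] R x y := rfl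

section Bioperators

variable [CompleteSpace L]

/-- Weak complete boundedness of a bilinear operator between quantum spaces. -/
def IsWeaklyCompletelyBounded (ι : L ≃ₗᵢ[ℂ] HilbertTensor L L) (nE : QuantumNorm L E)
    (nF : QuantumNorm L F) (nG : QuantumNorm L G) (R : E →ₗ[ℂ] F →ₗ[ℂ] G) : Prop :=
  ∃ C : ℝ, ∀ (u : Ampl L E) (v : Ampl L F),
    nG.norm (weakAmplify ι R u v) ≤ C * nE.norm u * nF.norm v

/-- The weak completely bounded norm: the norm of the bilinear operator `R_w`. -/
def wcbNorm (ι : L ≃ₗᵢ[ℂ] HilbertTensor L L) (nE : QuantumNorm L E)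
    (nF : QuantumNorm L F) (nG : QuantumNorm L G) (R : E →ₗ[ℂ] F →ₗ[ℂ] G) : ℝ :=
  sInf {C : ℝ | 0 ≤ C ∧ ∀ (u : Ampl L E) (v : Ampl L F),
    nG.norm (weakAmplify ι R u v) ≤ C * nE.norm u * nF.norm v}

/-- Weak complete contractivity of a bilinear operator between quantum spaces. -/
def IsWeaklyCompletelyContractive (ι : L ≃ₗᵢ[ℂ] HilbertTensor L L) (nE : QuantumNorm L E)
    (nF : QuantumNorm L F) (nG : QuantumNorm L G) (R : E →ₗ[ℂ] F →ₗ[ℂ] G) : Prop :=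
  ∀ (u : Ampl L E) (v : Ampl L F), nG.norm (weakAmplify ι R u v) ≤ nE.norm u * nF.norm v

end Bioperators

end Quantum

/-- The pair `(Θ, θ)` is the four-named tensor product of the quantum spaces `E` and `F`, tested
against all quantum spaces `G` in the universe `w`: `θ` is weakly completely contractive, and every
weakly completely contractive bilinear operator factors through `θ` by exactly one completely
contractive linear operator. -/
def IsFourNamedTensorProduct {L : Type u} [NormedAddCommGroup L]
    [InnerProductSpace ℂ L] [CompleteSpace L] (ι : L ≃ₗᵢ[ℂ] HilbertTensor L L)
    {E : Type v₁} [AddCommGroup E] [Module ℂ E] {F : Type v₂} [AddCommGroup F] [Module ℂ F]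
    {Θ : Type v₃} [AddCommGroup Θ] [Module ℂ Θ]
    (nE : QuantumNorm L E) (nF : QuantumNorm L F) (nΘ : QuantumNorm L Θ)
    (θ : E →ₗ[ℂ] F →ₗ[ℂ] Θ) : Prop :=
  IsWeaklyCompletelyContractive ι nE nF nΘ θ ∧
  ∀ (G : Type w) [AddCommGroup G] [Module ℂ G] (nG : QuantumNorm L G) (R : E →ₗ[ℂ] F →ₗ[ℂ] G),
    IsWeaklyCompletelyContractive ι nE nF nG R →
    ∃! S : Θ →ₗ[ℂ] G, IsCompletelyContractive nΘ nG S ∧ ∀ x y, S (θ x y) = R x y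

/-! ### The four-named norm -/

section Projective

variable {X₁ X₂ X₃ X₄ : Type*} [AddCommGroup X₁] [Module ℂ X₁] [AddCommGroup X₂] [Module ℂ X₂]
  [AddCommGroup X₃] [Module ℂ X₃] [AddCommGroup X₄] [Module ℂ X₄]

/-- The projective norm on `X₁ ⊗ X₂ ⊗ X₃ ⊗ X₄`, for given norms on the factors. -/
def projNorm (p₁ : Seminorm ℂ X₁) (p₂ : Seminorm ℂ X₂) (p₃ : Seminorm ℂ X₃) (p₄ : Seminorm ℂ X₄)
    (z : X₁ ⊗[ℂ] (X₂ ⊗[ℂ] (X₃ ⊗[ℂ] X₄))) : ℝ :=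
  sInf {r : ℝ | ∃ (n : ℕ) (x₁ : Fin n → X₁) (x₂ : Fin n → X₂) (x₃ : Fin n → X₃) (x₄ : Fin n → X₄),
    z = ∑ k, x₁ k ⊗ₜ[ℂ] (x₂ k ⊗ₜ[ℂ] (x₃ k ⊗ₜ[ℂ] x₄ k)) ∧
    r = ∑ k, p₁ (x₁ k) * p₂ (x₂ k) * p₃ (x₃ k) * p₄ (x₄ k)}

end Projective

section FourNamed

variable {L : Type*} [NormedAddCommGroup L] [InnerProductSpace ℂ L]

/-- The extended diamond operation `u ⋄ v`, i.e. the weak amplification of the canonical bilinear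
operator `(x, y) ↦ x ⊗ y`; thus `a x ⋄ b y = (a ⋄ b) (x ⊗ y)`. -/
def extDiamond (ι : L ≃ₗᵢ[ℂ] HilbertTensor L L)
    {E F : Type*} [AddCommGroup E] [Module ℂ E] [AddCommGroup F] [Module ℂ F] :
    Ampl L E →ₗ[ℂ] Ampl L F →ₗ[ℂ] Ampl L (E ⊗[ℂ] F) :=
  weakAmplify ι (TensorProduct.mk ℂ E F)

/-- The linear operator `𝒦 ⊗ 𝒦E ⊗ 𝒦F ⊗ 𝒦 → 𝒦(E ⊗ F)` with `b ⊗ u ⊗ v ⊗ d ↦ b · (u ⋄ v) · d`. -/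
def riggedDiamond (ι : L ≃ₗᵢ[ℂ] HilbertTensor L L)
    (E F : Type*) [AddCommGroup E] [Module ℂ E] [AddCommGroup F] [Module ℂ F] :
    Cpt L ⊗[ℂ] (Ampl L E ⊗[ℂ] (Ampl L F ⊗[ℂ] Cpt L)) →ₗ[ℂ] Ampl L (E ⊗[ℂ] F) :=
  TensorProduct.lift (lact ∘ₗ (Cpt L).subtype) ∘ₗ
    LinearMap.lTensor (Cpt L)
      (TensorProduct.lift ((ract ∘ₗ (Cpt L).subtype).flip ∘ₗ TensorProduct.lift (extDiamond ι)) ∘ₗ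
        (TensorProduct.assoc ℂ (Ampl L E) (Ampl L F) (Cpt L)).symm.toLinearMap)

theorem riggedDiamond_tmul (ι : L ≃ₗᵢ[ℂ] HilbertTensor L L)
    {E F : Type*} [AddCommGroup E] [Module ℂ E] [AddCommGroup F] [Module ℂ F]
    (b d : Cpt L) (u : Ampl L E) (v : Ampl L F) :
    riggedDiamond ι E F (b ⊗ₜ[ℂ] (u ⊗ₜ[ℂ] (v ⊗ₜ[ℂ] d))) =
      lact (b : L →L[ℂ] L) (ract (d : L →L[ℂ] L) (extDiamond ι u v)) := rfl

/-- The four-named seminorm `‖U‖₄` on `𝒦(E ⊗ F)`: the quotient, under `riggedDiamond`, of the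
projective norm on `𝒦 ⊗ 𝒦E ⊗ 𝒦F ⊗ 𝒦`. -/
def fourNorm [CompleteSpace L] (ι : L ≃ₗᵢ[ℂ] HilbertTensor L L)
    {E F : Type*} [AddCommGroup E] [Module ℂ E] [AddCommGroup F] [Module ℂ F]
    (nE : QuantumNorm L E) (nF : QuantumNorm L F) (U : Ampl L (E ⊗[ℂ] F)) : ℝ :=
  sInf {r : ℝ | ∃ z : Cpt L ⊗[ℂ] (Ampl L E ⊗[ℂ] (Ampl L F ⊗[ℂ] Cpt L)),
    riggedDiamond ι E F z = U ∧
    r = projNorm (normSeminorm ℂ (Cpt L)) nE.norm nF.norm (normSeminorm ℂ (Cpt L)) z}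

end FourNamed

end QuantumTensor

end

/-!
# The four-named tensor product of quantum spaces

Two facts about `L` carry the proof. Since `L` is infinite-dimensional and isomorphic to its Hilbert
square, it has infinitely many isometries `J_n` with mutually orthogonal ranges, namely
`J_n x = ι* (x ⊗ e_n)` for an orthonormal sequence `e_n` (`exists_orthogonal_isometries`). And every
compact operator is a product `b c d` of compact operators
(`exists_eq_mul_mul_of_isCompactOperator`).

*Surjectivity.* For a unit vector `e`, the projection `p` onto `e` and the isometry
`S x = ι* (x ⊗ e)` one has `c = S* (c ⋄ p) S`, so that
`(b c d) (x ⊗ y) = (b S*) · (c x ⋄ p y) · (S d)` (`riggedDiamond_surjective`).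

*Quantum norm.* Subadditivity, homogeneity and the first axiom of Ruan are read off from
representations `U = ∑ b_k · (u_k ⋄ v_k) · d_k`. For the second axiom, such a sum is compressed to a
single term `b · (u ⋄ v) · d`, where `u = ∑ J_k · u_k · J_k*` and `v = ∑ J_k · v_k · J_k*` are block
diagonal, so that their norms are maxima by the second axiom in `E` and `F`, while
`b = ∑ b_k (J_k ⋄ J_k)*` and `d = ∑ (J_k ⋄ J_k) d_k` (`lact_ract_extDiamond_blocks`). When half of the
terms is supported on `P` and the other half on `Q ⟂ P`, the norms of `b` and `d` are governed by the
larger of the two halves (`norm_sum_mul_le_sqrt`). For definiteness, bounded functionals `f`, `g` on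
`E`, `F` have bounded slice maps `𝒦E → 𝒦`, `𝒦F → 𝒦` (`norm_slice_le`), hence the slice map of `f ⊗ g`
is bounded for `‖·‖₄`; by the Hahn–Banach theorem these slice maps separate the points of
`𝒦(E ⊗ F)`.

*Universal property.* `‖·‖₄` is the largest subadditive function with a given bound on the elements
`b · (u ⋄ v) · d` (`le_mul_fourNorm`), so the linearization of `R` is bounded by every bound of `R_w`.
Conversely `‖u ⋄ v‖₄ ≤ ‖u‖ ‖v‖` (`fourNorm_extDiamond_le`): cutting down by `P ⋄ P` with a finite rank
projection `P` gives an element satisfying this estimate, and these elements converge to `u ⋄ v`.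
-/

noncomputable section

namespace QuantumTensor

/-! ### The diamond operation and isometries with orthogonal ranges -/

section HilbertOperators

open scoped InnerProductSpace
open Filter Topology

variable {L : Type*} [NormedAddCommGroup L] [InnerProductSpace ℂ L]

theorem hilbertMap_mul (a b c d : L →L[ℂ] L) :
    hilbertMap (a * c) (b * d) = hilbertMap a b * hilbertMap c d := by
  apply hilbertMap_ext
  intro z
  rw [mul_apply_eq_comp, hilbertMap_incl, hilbertMap_incl, hilbertMap_incl]
  congr 1
  induction z using TensorProduct.induction_on with
  | zero => simp
  | tmul x y => simp
  | add z w hz hw => simp only [map_add, hz, hw]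

theorem diamond_mul (ι : L ≃ₗᵢ[ℂ] HilbertTensor L L) (a b c d : L →L[ℂ] L) :
    diamond ι (a * c) (b * d) = diamond ι a b * diamond ι c d := by
  ext x
  simp [diamond_apply, hilbertMap_mul]

theorem diamond_one (ι : L ≃ₗᵢ[ℂ] HilbertTensor L L) : diamond ι 1 1 = 1 := by
  have h : hilbertMap (1 : L →L[ℂ] L) (1 : L →L[ℂ] L) = ContinuousLinearMap.id ℂ _ := by
    apply hilbertMap_ext
    intro z
    rw [hilbertMap_incl]
    induction z using TensorProduct.induction_on with
    | zero => simp
    | tmul x y => simp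
    | add z w hz hw => simp only [map_add, hz, hw]
  ext x
  simp [diamond_apply, h]

/-- `⋄` on bounded operators, as a bilinear map. -/
def diamondBilin (ι : L ≃ₗᵢ[ℂ] HilbertTensor L L) :
    (L →L[ℂ] L) →ₗ[ℂ] (L →L[ℂ] L) →ₗ[ℂ] (L →L[ℂ] L) :=
  LinearMap.mk₂ ℂ (diamond ι)
    (fun a a' b => ContinuousLinearMap.ext fun x => by
      simp [diamond_apply, hilbertMap_add_left])
    (fun c a b => ContinuousLinearMap.ext fun x => by
      simp [diamond_apply, hilbertMap_smul_left])
    (fun a b b' => ContinuousLinearMap.ext fun x => by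
      simp [diamond_apply, hilbertMap_add_right])
    (fun c a b => ContinuousLinearMap.ext fun x => by
      simp [diamond_apply, hilbertMap_smul_right])

theorem diamond_zero_left (ι : L ≃ₗᵢ[ℂ] HilbertTensor L L) (b : L →L[ℂ] L) : diamond ι 0 b = 0 :=
  LinearMap.map_zero₂ (diamondBilin ι) b

theorem diamond_zero_right (ι : L ≃ₗᵢ[ℂ] HilbertTensor L L) (a : L →L[ℂ] L) : diamond ι a 0 = 0 :=
  map_zero (diamondBilin ι a)

theorem norm_diamond_le (ι : L ≃ₗᵢ[ℂ] HilbertTensor L L) (a b : L →L[ℂ] L) :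
    ‖diamond ι a b‖ ≤ ‖a‖ * ‖b‖ := by
  refine ContinuousLinearMap.opNorm_le_bound _ (by positivity) fun x => ?_
  rw [diamond_apply, LinearIsometryEquiv.norm_map]
  refine ((hilbertMap a b).le_opNorm _).trans ?_
  rw [LinearIsometryEquiv.norm_map]
  exact mul_le_mul_of_nonneg_right (norm_hilbertMap_le a b) (norm_nonneg _)

theorem tendsto_diamond (ι : L ≃ₗᵢ[ℂ] HilbertTensor L L) {α : Type*} {l : Filter α}
    {f g : α → L →L[ℂ] L} {a b : L →L[ℂ] L} (hf : Tendsto f l (𝓝 a)) (hg : Tendsto g l (𝓝 b)) :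
    Tendsto (fun t => diamond ι (f t) (g t)) l (𝓝 (diamond ι a b)) := by
  have h := ((LinearMap.mkContinuous₂ (diamondBilin ι) 1 fun a b => by
    rw [one_mul]; exact norm_diamond_le ι a b).continuous₂.tendsto (a, b)).comp
    (hf.prodMk_nhds hg)
  exact h

theorem inner_hilbertMap [CompleteSpace L] (a b : L →L[ℂ] L) (z w : HilbertTensor L L) :
    ⟪hilbertMap a b z, w⟫_ℂ = ⟪z, hilbertMap (star a) (star b) w⟫_ℂ := by
  induction z using (denseRange_hilbertIncl L L).induction_on with
  | hp => exact isClosed_eq (by fun_prop) (by fun_prop)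
  | ih z =>
    induction w using (denseRange_hilbertIncl L L).induction_on with
    | hp => exact isClosed_eq (by fun_prop) (by fun_prop)
    | ih w =>
      rw [hilbertMap_incl, hilbertMap_incl, LinearIsometry.inner_map_map,
        LinearIsometry.inner_map_map]
      induction z using TensorProduct.induction_on with
      | zero => simp
      | add z z' hz hz' => simp only [map_add, inner_add_left, hz, hz']
      | tmul x y =>
        induction w using TensorProduct.induction_on with
        | zero => simp
        | add w w' hw hw' => simp only [map_add, inner_add_right, hw, hw']
        | tmul x' y' =>
          simp [ContinuousLinearMap.star_eq_adjoint, ContinuousLinearMap.adjoint_inner_right]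

theorem star_diamond [CompleteSpace L] (ι : L ≃ₗᵢ[ℂ] HilbertTensor L L) (a b : L →L[ℂ] L) :
    star (diamond ι a b) = diamond ι (star a) (star b) := by
  symm
  rw [ContinuousLinearMap.star_eq_adjoint (diamond ι a b), ContinuousLinearMap.eq_adjoint_iff]
  intro x y
  rw [diamond_apply, diamond_apply, ← ι.inner_map_map, ← ι.inner_map_map,
    LinearIsometryEquiv.apply_symm_apply, LinearIsometryEquiv.apply_symm_apply,
    inner_hilbertMap, star_star, star_star]

/-- The operator `x ↦ ι* (x ⊗ e)` on `L`; an isometry when `e` is a unit vector. -/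
def tensorRight (ι : L ≃ₗᵢ[ℂ] HilbertTensor L L) (e : L) : L →L[ℂ] L :=
  (ι.symm.toContinuousLinearEquiv : HilbertTensor L L →L[ℂ] L) ∘L
    (hilbertIncl L L).toContinuousLinearMap ∘L (TensorProduct.mkL ℂ L L).flip e

theorem tensorRight_apply (ι : L ≃ₗᵢ[ℂ] HilbertTensor L L) (e x : L) :
    tensorRight ι e x = ι.symm (hilbertIncl L L (x ⊗ₜ e)) := rfl

theorem star_tensorRight_mul [CompleteSpace L] (ι : L ≃ₗᵢ[ℂ] HilbertTensor L L) (e e' : L) :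
    star (tensorRight ι e) * tensorRight ι e' = ⟪e, e'⟫_ℂ • (1 : L →L[ℂ] L) := by
  ext x
  refine ext_inner_left ℂ fun y => ?_
  rw [mul_apply_eq_comp, ContinuousLinearMap.star_eq_adjoint,
    ContinuousLinearMap.adjoint_inner_right, tensorRight_apply, tensorRight_apply,
    LinearIsometryEquiv.inner_map_map, LinearIsometry.inner_map_map]
  simp [inner_smul_right, mul_comm]

theorem diamond_mul_tensorRight (ι : L ≃ₗᵢ[ℂ] HilbertTensor L L) (a b : L →L[ℂ] L) (e : L) :
    diamond ι a b * tensorRight ι e = tensorRight ι (b e) * a := by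
  ext x
  simp [diamond_apply, tensorRight_apply, hilbertMap_tmul]

/-- Infinitely many isometries of `L` with mutually orthogonal ranges. -/
theorem exists_orthogonal_isometries [CompleteSpace L] (hL : ¬ FiniteDimensional ℂ L)
    (ι : L ≃ₗᵢ[ℂ] HilbertTensor L L) :
    ∃ J : ℕ → L →L[ℂ] L, ∀ n m, star (J n) * J m = if n = m then 1 else 0 := by
  obtain ⟨f, hf⟩ : ∃ f : ℕ → L, LinearIndependent ℂ f := by
    let B := Module.Basis.ofVectorSpace ℂ L
    have : Infinite (Module.Basis.ofVectorSpaceIndex ℂ L) := by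
      by_contra h
      rw [not_infinite_iff_finite] at h
      exact hL (Module.Finite.of_basis B)
    exact ⟨_, B.linearIndependent.comp _ (Infinite.natEmbedding _).injective⟩
  have ho := InnerProductSpace.gramSchmidtNormed_orthonormal hf
  refine ⟨fun n => tensorRight ι (InnerProductSpace.gramSchmidtNormed ℂ f n), fun n m => ?_⟩
  rw [star_tensorRight_mul, orthonormal_iff_ite.1 ho]
  split_ifs <;> simp

theorem norm_le_one_of_star_mul_self [CompleteSpace L] {J : L →L[ℂ] L} (hJ : star J * J = 1) : ‖J‖ ≤ 1 := by
  have h : ‖J‖ * ‖J‖ = ‖(1 : L →L[ℂ] L)‖ := by rw [← CStarRing.norm_star_mul_self, hJ]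
  have h1 : ‖(1 : L →L[ℂ] L)‖ ≤ 1 := ContinuousLinearMap.norm_id_le
  nlinarith [norm_nonneg J]

theorem exists_unit_vector (hL : ¬ FiniteDimensional ℂ L) : ∃ e : L, ‖e‖ = 1 := by
  have : Nontrivial L := by
    by_contra h
    rw [not_nontrivial_iff_subsingleton] at h
    exact hL inferInstance
  obtain ⟨x, hx⟩ := exists_norm_eq L (zero_le_one' ℝ)
  exact ⟨x, hx⟩

end HilbertOperators

/-! ### Approximation and factorization of compact operators -/

section Compact

open Filter Topology

variable {L : Type*} [NormedAddCommGroup L] [InnerProductSpace ℂ L]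

/-- The orthogonal projection onto the span of a finite set of vectors. -/
def spanProj (t : Finset L) : L →L[ℂ] L :=
  have : FiniteDimensional ℂ (Submodule.span ℂ (t : Set L)) := FiniteDimensional.span_finset ℂ t
  (Submodule.span ℂ (t : Set L)).starProjection

theorem isStarProjection_spanProj [CompleteSpace L] (t : Finset L) : IsStarProjection (spanProj t) :=
  isStarProjection_starProjection

theorem norm_spanProj_le (t : Finset L) : ‖spanProj t‖ ≤ 1 :=
  Submodule.starProjection_norm_le _

theorem isCompactOperator_spanProj (t : Finset L) : IsCompactOperator (spanProj t) := by
  have : FiniteDimensional ℂ (Submodule.span ℂ (t : Set L)) := FiniteDimensional.span_finset ℂ t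
  exact isCompactOperator_of_finiteRange (Submodule.span ℂ (t : Set L)) fun x => by
    simp [spanProj]

theorem tendsto_spanProj_mul {a : L →L[ℂ] L} (ha : IsCompactOperator a) :
    Tendsto (fun t => spanProj t * a) atTop (𝓝 a) := by
  rw [Metric.tendsto_nhds]
  intro ε hε
  have hc := IsCompactOperator.isCompact_closure_image_closedBall (f := (a : L →ₗ[ℂ] L)) ha 1
  obtain ⟨t, ht, hcov⟩ := Metric.totallyBounded_iff.1 hc.totallyBounded (ε / 2) (half_pos hε)
  filter_upwards [eventually_ge_atTop ht.toFinset] with s hs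
  have : FiniteDimensional ℂ (Submodule.span ℂ (s : Set L)) := FiniteDimensional.span_finset ℂ s
  rw [dist_comm, dist_eq_norm]
  refine lt_of_le_of_lt ?_ (half_lt_self hε)
  refine ContinuousLinearMap.opNorm_le_of_unit_norm (half_pos hε).le fun x hx => ?_
  have hmem : a x ∈ closure ((a : L →ₗ[ℂ] L) '' Metric.closedBall 0 1) :=
    subset_closure ⟨x, by simp [hx], rfl⟩
  obtain ⟨y, hy, hxy⟩ := Set.mem_iUnion₂.1 (hcov hmem)
  have h1 : ‖a x - spanProj s (a x)‖ ≤ ‖a x - y‖ := by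
    rw [spanProj, Submodule.starProjection_minimal]
    exact ciInf_le ⟨0, by rintro _ ⟨w, rfl⟩; exact norm_nonneg _⟩
      (⟨y, Submodule.subset_span (hs (ht.mem_toFinset.2 hy))⟩ : Submodule.span ℂ (s : Set L))
  rw [Metric.mem_ball, dist_eq_norm] at hxy
  exact h1.trans hxy.le

/-- Schauder's theorem on a Hilbert space: the adjoint of a compact operator is compact. -/
theorem isCompactOperator_star [CompleteSpace L] {a : L →L[ℂ] L} (ha : IsCompactOperator a) :
    IsCompactOperator (star a : L →L[ℂ] L) := by
  have hcl : IsClosed {T : L →L[ℂ] L | IsCompactOperator T} :=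
    isClosed_setOfPred_isCompactOperator
  have h : Tendsto (fun t => star (spanProj t * a)) atTop (𝓝 (star a)) :=
    ((continuous_star (R := L →L[ℂ] L)).tendsto a).comp (tendsto_spanProj_mul ha)
  refine hcl.mem_of_tendsto h (Eventually.of_forall fun t => ?_)
  rw [Set.mem_ofPred_eq, star_mul, (isStarProjection_spanProj t).isSelfAdjoint.star_eq]
  exact (isCompactOperator_spanProj t).clm_comp (star a)

theorem tendsto_mul_spanProj [CompleteSpace L] {a : L →L[ℂ] L} (ha : IsCompactOperator a) :
    Tendsto (fun t => a * spanProj t) atTop (𝓝 a) := by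
  have h := ((continuous_star (R := L →L[ℂ] L)).tendsto (star a)).comp
    (tendsto_spanProj_mul (isCompactOperator_star ha))
  rw [star_star] at h
  refine h.congr fun t => ?_
  simp [star_mul, (isStarProjection_spanProj t).isSelfAdjoint.star_eq]

/-- Every compact operator is the product of two compact operators. The factors are assembled
from finite rank pieces placed along isometries with orthogonal ranges: if `s₀ = a` and
`sₙ₊₁ = sₙ - qₙ sₙ` is small, then `a = (∑ 2⁻ⁿ qₙ Jₙ*) (∑ 2ⁿ Jₙ sₙ)`. -/
theorem exists_eq_mul_of_isCompactOperator [CompleteSpace L] (hL : ¬ FiniteDimensional ℂ L)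
    (ι : L ≃ₗᵢ[ℂ] HilbertTensor L L) {a : L →L[ℂ] L} (ha : IsCompactOperator a) :
    ∃ b c : L →L[ℂ] L, IsCompactOperator b ∧ IsCompactOperator c ∧ a = b * c := by
  obtain ⟨J, hJ⟩ := exists_orthogonal_isometries hL ι
  have hJn : ∀ n, ‖J n‖ ≤ 1 := fun n => norm_le_one_of_star_mul_self (by rw [hJ, if_pos rfl])
  have hstep : ∀ (s : Cpt L) (n : ℕ), ∃ q : Cpt L, ‖(q : L →L[ℂ] L)‖ ≤ 1 ∧
      ‖(s : L →L[ℂ] L) - q * s‖ ≤ (1 / 4) ^ (n + 1) := by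
    intro s n
    have h := Metric.tendsto_nhds.1 (tendsto_spanProj_mul s.2) ((1 / 4) ^ (n + 1)) (by positivity)
    obtain ⟨t, ht⟩ := h.exists
    rw [dist_comm, dist_eq_norm] at ht
    exact ⟨⟨spanProj t, isCompactOperator_spanProj t⟩, norm_spanProj_le t, ht.le⟩
  choose Q hQ1 hQ2 using hstep
  obtain ⟨s, hs0, hs'⟩ : ∃ s : ℕ → Cpt L, s 0 = ⟨a, ha⟩ ∧
      ∀ n, s (n + 1) = s n - cptMulLeft (Q (s n) n) (s n) :=
    ⟨fun n => Nat.rec ⟨a, ha⟩ (fun n s => s - cptMulLeft (Q s n) s) n, rfl, fun _ => rfl⟩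
  let q : ℕ → L →L[ℂ] L := fun n => Q (s n) n
  have hs : ∀ n, (s (n + 1) : L →L[ℂ] L) = s n - q n * s n := fun n => by rw [hs' n]; rfl
  have hq : ∀ n, ‖q n‖ ≤ 1 := fun n => hQ1 _ _
  have hsn : ∀ n, ‖(s n : L →L[ℂ] L)‖ ≤ (‖a‖ + 1) * (1 / 4) ^ n := by
    intro n
    cases n with
    | zero => simp [hs0]
    | succ n =>
      rw [hs]
      exact (hQ2 (s n) n).trans (le_mul_of_one_le_left (by positivity) (by simp))
  have hcl : IsClosed {T : L →L[ℂ] L | IsCompactOperator T} :=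
    isClosed_setOfPred_isCompactOperator
  have hcompact : ∀ {f : ℕ → L →L[ℂ] L} {T}, HasSum f T → (∀ n, IsCompactOperator (f n)) →
      IsCompactOperator T := fun {f T} hf h =>
    hcl.mem_of_tendsto hf (Eventually.of_forall fun t => (Cpt L).sum_mem fun n _ => h n)
  let f : ℕ → L →L[ℂ] L := fun n => (1 / 2 : ℂ) ^ n • (q n * star (J n))
  let g : ℕ → L →L[ℂ] L := fun n => (2 : ℂ) ^ n • (J n * s n)
  have hf : Summable f := by
    refine Summable.of_norm_bounded (summable_geometric_two) fun n => ?_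
    rw [norm_smul, norm_pow]
    have h1 : ‖q n * star (J n)‖ ≤ 1 * 1 :=
      (norm_mul_le _ _).trans (mul_le_mul (hq n) (by rw [norm_star]; exact hJn n)
        (norm_nonneg _) zero_le_one)
    calc _ ≤ ‖(1 / 2 : ℂ)‖ ^ n * (1 * 1) := by gcongr
      _ = _ := by norm_num
  have hg : Summable g := by
    refine Summable.of_norm_bounded (summable_geometric_two.mul_left (‖a‖ + 1)) fun n => ?_
    rw [norm_smul, norm_pow]
    have h1 : ‖J n * (s n : L →L[ℂ] L)‖ ≤ 1 * ((‖a‖ + 1) * (1 / 4) ^ n) :=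
      (norm_mul_le _ _).trans (mul_le_mul (hJn n) (hsn n) (norm_nonneg _) zero_le_one)
    calc _ ≤ ‖(2 : ℂ)‖ ^ n * (1 * ((‖a‖ + 1) * (1 / 4) ^ n)) := by gcongr
      _ = (‖a‖ + 1) * (2 * (1 / 4)) ^ n := by
        rw [mul_pow]
        norm_num
        ring
      _ = _ := by norm_num
  have hfJ : ∀ m, (∑' n, f n) * J m = (1 / 2 : ℂ) ^ m • q m := by
    intro m
    refine (hf.hasSum.mul_right (J m)).unique ?_
    have h : (fun n => f n * J m) = fun n => if n = m then (1 / 2 : ℂ) ^ m • q m else 0 := by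
      funext n
      simp only [f, smul_mul_assoc, mul_assoc, hJ]
      split_ifs with h
      · rw [h, mul_one]
      · simp
    rw [h]
    exact hasSum_ite_eq m _
  refine ⟨∑' n, f n, ∑' n, g n,
    hcompact hf.hasSum fun n => (Cpt L).smul_mem _ ?_,
    hcompact hg.hasSum fun n => (Cpt L).smul_mem _ ?_, ?_⟩
  · exact (Q (s n) n).2.comp_clm (star (J n))
  · exact (s n).2.clm_comp (J n)
  have h1 := (hg.hasSum.mul_left (∑' n, f n)).tendsto_sum_nat
  have h2 : ∀ n, (∑' n, f n) * g n = (s n : L →L[ℂ] L) - s (n + 1) := fun n => by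
    simp only [g]
    rw [mul_smul_comm, ← mul_assoc, hfJ, smul_mul_assoc, smul_smul, ← mul_pow, hs]
    norm_num
  simp only [h2, Finset.sum_range_sub'] at h1
  refine tendsto_nhds_unique (f := fun n => (s 0 : L →L[ℂ] L) - s n) (l := atTop) ?_ h1
  have h0 : Tendsto (fun n => (s n : L →L[ℂ] L)) atTop (𝓝 0) := by
    refine squeeze_zero_norm hsn ?_
    rw [← mul_zero (‖a‖ + 1)]
    exact (tendsto_pow_atTop_nhds_zero_of_lt_one (by norm_num) (by norm_num)).const_mul _
  simpa [hs0] using (tendsto_const_nhds (x := a)).sub h0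

theorem exists_eq_mul_mul_of_isCompactOperator [CompleteSpace L] (hL : ¬ FiniteDimensional ℂ L)
    (ι : L ≃ₗᵢ[ℂ] HilbertTensor L L) (a : Cpt L) :
    ∃ b c d : Cpt L, a = cptMulLeft (b : L →L[ℂ] L) (cptMulRight (d : L →L[ℂ] L) c) := by
  obtain ⟨b, c, hb, hc, h⟩ := exists_eq_mul_of_isCompactOperator hL ι a.2
  obtain ⟨c', d, hc', hd, rfl⟩ := exists_eq_mul_of_isCompactOperator hL ι hc
  exact ⟨⟨b, hb⟩, ⟨c', hc'⟩, ⟨d, hd⟩, Subtype.ext h⟩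

theorem isCompactOperator_rankOne (x y : L) : IsCompactOperator (InnerProductSpace.rankOne ℂ x y : L →L[ℂ] L) :=
  isCompactOperator_of_finiteRange (Submodule.span ℂ {x}) fun _ =>
    Submodule.smul_mem _ _ (Submodule.mem_span_singleton_self x)

/-- The rank one projection onto the line of a unit vector, as a compact operator. -/
def cptRankOne (e : L) : Cpt L := ⟨InnerProductSpace.rankOne ℂ e e, isCompactOperator_rankOne e e⟩

end Compact

/-! ### The bimodule structure of amplifications -/

section Bimodule

variable {L : Type*} [NormedAddCommGroup L] [InnerProductSpace ℂ L]
variable {E : Type*} [AddCommGroup E] [Module ℂ E] {F : Type*} [AddCommGroup F] [Module ℂ F]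
  {G : Type*} [AddCommGroup G] [Module ℂ G] {H : Type*} [AddCommGroup H] [Module ℂ H]

theorem lact_lact (a b : L →L[ℂ] L) (u : Ampl L E) : lact a (lact b u) = lact (a * b) u := by
  induction u using TensorProduct.induction_on with
  | zero => simp
  | tmul c x => rfl
  | add u v hu hv => simp only [map_add, hu, hv]

theorem ract_ract (a b : L →L[ℂ] L) (u : Ampl L E) : ract a (ract b u) = ract (b * a) u := by
  induction u using TensorProduct.induction_on with
  | zero => simp
  | tmul c x => rfl
  | add u v hu hv => simp only [map_add, hu, hv]

theorem ract_lact (a b : L →L[ℂ] L) (u : Ampl L E) : ract a (lact b u) = lact b (ract a u) := by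
  induction u using TensorProduct.induction_on with
  | zero => simp
  | tmul c x => rfl
  | add u v hu hv => simp only [map_add, hu, hv]

theorem weakAmplify_lact (ι : L ≃ₗᵢ[ℂ] HilbertTensor L L) (R : E →ₗ[ℂ] F →ₗ[ℂ] G)
    (a b : L →L[ℂ] L) (u : Ampl L E) (v : Ampl L F) :
    weakAmplify ι R (lact a u) (lact b v) = lact (diamond ι a b) (weakAmplify ι R u v) := by
  induction u using TensorProduct.induction_on with
  | zero => simp
  | add u u' hu hu' => simp only [map_add, LinearMap.add_apply, hu, hu']
  | tmul c x =>
    induction v using TensorProduct.induction_on with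
    | zero => simp
    | add v v' hv hv' => simp only [map_add, hv, hv']
    | tmul d y =>
      rw [lact_tmul, lact_tmul, weakAmplify_tmul, weakAmplify_tmul, lact_tmul]
      congr 1
      exact Subtype.ext (diamond_mul ι a b c d)

theorem weakAmplify_ract (ι : L ≃ₗᵢ[ℂ] HilbertTensor L L) (R : E →ₗ[ℂ] F →ₗ[ℂ] G)
    (a b : L →L[ℂ] L) (u : Ampl L E) (v : Ampl L F) :
    weakAmplify ι R (ract a u) (ract b v) = ract (diamond ι a b) (weakAmplify ι R u v) := by
  induction u using TensorProduct.induction_on with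
  | zero => simp
  | add u u' hu hu' => simp only [map_add, LinearMap.add_apply, hu, hu']
  | tmul c x =>
    induction v using TensorProduct.induction_on with
    | zero => simp
    | add v v' hv hv' => simp only [map_add, hv, hv']
    | tmul d y =>
      rw [ract_tmul, ract_tmul, weakAmplify_tmul, weakAmplify_tmul, ract_tmul]
      congr 1
      exact Subtype.ext (diamond_mul ι c d a b)

theorem amplify_lact (φ : E →ₗ[ℂ] F) (a : L →L[ℂ] L) (u : Ampl L E) :
    amplify L φ (lact a u) = lact a (amplify L φ u) := by
  induction u using TensorProduct.induction_on with
  | zero => simp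
  | tmul c x => rfl
  | add u v hu hv => simp only [map_add, hu, hv]

theorem amplify_ract (φ : E →ₗ[ℂ] F) (a : L →L[ℂ] L) (u : Ampl L E) :
    amplify L φ (ract a u) = ract a (amplify L φ u) := by
  induction u using TensorProduct.induction_on with
  | zero => simp
  | tmul c x => rfl
  | add u v hu hv => simp only [map_add, hu, hv]

theorem amplify_extDiamond (ι : L ≃ₗᵢ[ℂ] HilbertTensor L L) (φ : E ⊗[ℂ] F →ₗ[ℂ] G)
    (R : E →ₗ[ℂ] F →ₗ[ℂ] G) (h : ∀ x y, φ (x ⊗ₜ y) = R x y) (u : Ampl L E) (v : Ampl L F) :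
    amplify L φ (extDiamond ι u v) = weakAmplify ι R u v := by
  induction u using TensorProduct.induction_on with
  | zero => simp
  | add u u' hu hu' => simp only [map_add, LinearMap.add_apply, hu, hu']
  | tmul c x =>
    induction v using TensorProduct.induction_on with
    | zero => simp
    | add v v' hv hv' => simp only [map_add, hv, hv']
    | tmul d y =>
      rw [extDiamond, weakAmplify_tmul, weakAmplify_tmul, ← h]
      rfl

theorem extDiamond_lact (ι : L ≃ₗᵢ[ℂ] HilbertTensor L L) (a b : L →L[ℂ] L)
    (u : Ampl L E) (v : Ampl L F) :
    extDiamond ι (lact a u) (lact b v) = lact (diamond ι a b) (extDiamond ι u v) :=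
  weakAmplify_lact ι _ a b u v

theorem extDiamond_ract (ι : L ≃ₗᵢ[ℂ] HilbertTensor L L) (a b : L →L[ℂ] L)
    (u : Ampl L E) (v : Ampl L F) :
    extDiamond ι (ract a u) (ract b v) = ract (diamond ι a b) (extDiamond ι u v) :=
  weakAmplify_ract ι _ a b u v

/-- Surjectivity of the operator defining `‖·‖₄`. Given a compact `a = b c d`, a unit vector `e`,
the isometry `S x = ι* (x ⊗ e)` and the projection `p` onto `e`, one has `c = S* (c ⋄ p) S`, so that
`a (x ⊗ y) = (b S*) · (c x ⋄ p y) · (S d)`. -/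
theorem riggedDiamond_surjective [CompleteSpace L] (hL : ¬ FiniteDimensional ℂ L)
    (ι : L ≃ₗᵢ[ℂ] HilbertTensor L L) : Function.Surjective (riggedDiamond ι E F) := by
  obtain ⟨e, he⟩ := exists_unit_vector hL
  let p := cptRankOne e
  have hee : inner ℂ e e = (1 : ℂ) := by rw [inner_self_eq_norm_sq_to_K, he]; simp
  let S := tensorRight ι e
  have hp : (p : L →L[ℂ] L) e = e := by simp [p, cptRankOne, he]
  have hS : star S * S = 1 := by rw [star_tensorRight_mul, hee, one_smul]
  rw [← LinearMap.range_eq_top, eq_top_iff, ← TensorProduct.span_tmul_eq_top, Submodule.span_le]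
  rintro _ ⟨a, z, rfl⟩
  induction z using TensorProduct.induction_on with
  | zero => simp
  | add z w hz hw => rw [TensorProduct.tmul_add]; exact Submodule.add_mem _ hz hw
  | tmul x y =>
    obtain ⟨b, c, d, rfl⟩ := exists_eq_mul_mul_of_isCompactOperator hL ι a
    refine ⟨cptMulRight (star S) b ⊗ₜ ((c ⊗ₜ x) ⊗ₜ ((p ⊗ₜ y) ⊗ₜ cptMulLeft S d)), ?_⟩
    rw [riggedDiamond_tmul, extDiamond, weakAmplify_tmul, ract_tmul, lact_tmul]
    congr 1
    apply Subtype.ext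
    change (b : L →L[ℂ] L) * star S * (diamond ι c p * (S * d)) = b * (c * d)
    rw [← mul_assoc (diamond ι c p), diamond_mul_tensorRight, hp, mul_assoc, mul_assoc,
      ← mul_assoc (star S), hS, one_mul]

end Bimodule

/-! ### The four-named seminorm and the first axiom of Ruan -/

section FourNorm

variable {L : Type*} [NormedAddCommGroup L] [InnerProductSpace ℂ L] [CompleteSpace L]
variable {E : Type*} [AddCommGroup E] [Module ℂ E] {F : Type*} [AddCommGroup F] [Module ℂ F]

/-- The values `∑ ‖b_k‖ ‖u_k‖ ‖v_k‖ ‖d_k‖` over the representations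
`U = ∑ b_k · (u_k ⋄ v_k) · d_k`. -/
def representationValues (ι : L ≃ₗᵢ[ℂ] HilbertTensor L L) (nE : QuantumNorm L E)
    (nF : QuantumNorm L F) (U : Ampl L (E ⊗[ℂ] F)) : Set ℝ :=
  {r : ℝ | ∃ (n : ℕ) (b d : Fin n → Cpt L) (u : Fin n → Ampl L E) (v : Fin n → Ampl L F),
    U = ∑ k, lact (b k : L →L[ℂ] L) (ract (d k : L →L[ℂ] L) (extDiamond ι (u k) (v k))) ∧
    r = ∑ k, ‖b k‖ * nE.norm (u k) * nF.norm (v k) * ‖d k‖}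

variable {ι : L ≃ₗᵢ[ℂ] HilbertTensor L L} {nE : QuantumNorm L E} {nF : QuantumNorm L F}

theorem sum_mem_representationValues {κ : Type*} [Fintype κ] (b d : κ → Cpt L) (u : κ → Ampl L E)
    (v : κ → Ampl L F) :
    ∑ k, ‖b k‖ * nE.norm (u k) * nF.norm (v k) * ‖d k‖ ∈ representationValues ι nE nF
      (∑ k, lact (b k : L →L[ℂ] L) (ract (d k : L →L[ℂ] L) (extDiamond ι (u k) (v k)))) := by
  let e := (Fintype.equivFin κ).symm
  refine ⟨Fintype.card κ, b ∘ e, d ∘ e, u ∘ e, v ∘ e, ?_, ?_⟩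
  · exact (Equiv.sum_comp e _).symm
  · exact (Equiv.sum_comp e _).symm

theorem nonneg_of_mem_representationValues {U : Ampl L (E ⊗[ℂ] F)} {r : ℝ}
    (hr : r ∈ representationValues ι nE nF U) : 0 ≤ r := by
  obtain ⟨n, b, d, u, v, -, rfl⟩ := hr
  exact Finset.sum_nonneg fun k _ => mul_nonneg (mul_nonneg (mul_nonneg (norm_nonneg _)
    (apply_nonneg _ _)) (apply_nonneg _ _)) (norm_nonneg _)

theorem exists_eq_sum_tmul_four {X₁ X₂ X₃ X₄ : Type*} [AddCommGroup X₁] [Module ℂ X₁]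
    [AddCommGroup X₂] [Module ℂ X₂] [AddCommGroup X₃] [Module ℂ X₃] [AddCommGroup X₄] [Module ℂ X₄]
    (z : X₁ ⊗[ℂ] (X₂ ⊗[ℂ] (X₃ ⊗[ℂ] X₄))) :
    ∃ (n : ℕ) (x₁ : Fin n → X₁) (x₂ : Fin n → X₂) (x₃ : Fin n → X₃) (x₄ : Fin n → X₄),
      z = ∑ k, x₁ k ⊗ₜ[ℂ] (x₂ k ⊗ₜ[ℂ] (x₃ k ⊗ₜ[ℂ] x₄ k)) := by
  have hadd : ∀ z w : X₁ ⊗[ℂ] (X₂ ⊗[ℂ] (X₃ ⊗[ℂ] X₄)),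
      (∃ (n : ℕ) (x₁ : Fin n → X₁) (x₂ : Fin n → X₂) (x₃ : Fin n → X₃) (x₄ : Fin n → X₄),
        z = ∑ k, x₁ k ⊗ₜ[ℂ] (x₂ k ⊗ₜ[ℂ] (x₃ k ⊗ₜ[ℂ] x₄ k))) →
      (∃ (n : ℕ) (x₁ : Fin n → X₁) (x₂ : Fin n → X₂) (x₃ : Fin n → X₃) (x₄ : Fin n → X₄),
        w = ∑ k, x₁ k ⊗ₜ[ℂ] (x₂ k ⊗ₜ[ℂ] (x₃ k ⊗ₜ[ℂ] x₄ k))) →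
      ∃ (n : ℕ) (x₁ : Fin n → X₁) (x₂ : Fin n → X₂) (x₃ : Fin n → X₃) (x₄ : Fin n → X₄),
        z + w = ∑ k, x₁ k ⊗ₜ[ℂ] (x₂ k ⊗ₜ[ℂ] (x₃ k ⊗ₜ[ℂ] x₄ k)) := by
    rintro _ _ ⟨n, x₁, x₂, x₃, x₄, rfl⟩ ⟨m, y₁, y₂, y₃, y₄, rfl⟩
    exact ⟨n + m, Fin.append x₁ y₁, Fin.append x₂ y₂, Fin.append x₃ y₃, Fin.append x₄ y₄, by
      simp [Fin.sum_univ_add]⟩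
  induction z using TensorProduct.induction_on with
  | zero => exact ⟨0, Fin.elim0, Fin.elim0, Fin.elim0, Fin.elim0, by simp⟩
  | add z w hz hw => exact hadd _ _ hz hw
  | tmul x₁ z =>
    induction z using TensorProduct.induction_on with
    | zero => exact ⟨0, Fin.elim0, Fin.elim0, Fin.elim0, Fin.elim0, by simp⟩
    | add z w hz hw => rw [TensorProduct.tmul_add]; exact hadd _ _ hz hw
    | tmul x₂ z =>
      induction z using TensorProduct.induction_on with
      | zero => exact ⟨0, Fin.elim0, Fin.elim0, Fin.elim0, Fin.elim0, by simp⟩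
      | add z w hz hw =>
        rw [TensorProduct.tmul_add, TensorProduct.tmul_add]; exact hadd _ _ hz hw
      | tmul x₃ x₄ => exact ⟨1, fun _ => x₁, fun _ => x₂, fun _ => x₃, fun _ => x₄, by simp⟩

/-- `‖U‖₄` is the infimum over all representations of `U`. Surjectivity of `riggedDiamond` makes the
set of values nonempty, so that no junk value of `sInf` enters. -/
theorem isGLB_fourNorm (hL : ¬ FiniteDimensional ℂ L) (U : Ampl L (E ⊗[ℂ] F)) :
    IsGLB (representationValues ι nE nF U) (fourNorm ι nE nF U) := by
  have hproj : ∀ z : Cpt L ⊗[ℂ] (Ampl L E ⊗[ℂ] (Ampl L F ⊗[ℂ] Cpt L)),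
      IsGLB {r : ℝ | ∃ (n : ℕ) (x₁ : Fin n → Cpt L) (x₂ : Fin n → Ampl L E)
          (x₃ : Fin n → Ampl L F) (x₄ : Fin n → Cpt L),
        z = ∑ k, x₁ k ⊗ₜ[ℂ] (x₂ k ⊗ₜ[ℂ] (x₃ k ⊗ₜ[ℂ] x₄ k)) ∧
        r = ∑ k, normSeminorm ℂ (Cpt L) (x₁ k) * nE.norm (x₂ k) * nF.norm (x₃ k) *
          normSeminorm ℂ (Cpt L) (x₄ k)}
      (projNorm (normSeminorm ℂ (Cpt L)) nE.norm nF.norm (normSeminorm ℂ (Cpt L)) z) := by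
    intro z
    obtain ⟨n, x₁, x₂, x₃, x₄, h⟩ := exists_eq_sum_tmul_four z
    refine Real.isGLB_sInf ⟨_, n, x₁, x₂, x₃, x₄, h, rfl⟩ ⟨0, ?_⟩
    rintro _ ⟨n, x₁, x₂, x₃, x₄, -, rfl⟩
    exact Finset.sum_nonneg fun k _ => mul_nonneg (mul_nonneg (mul_nonneg (apply_nonneg _ _)
      (apply_nonneg _ _)) (apply_nonneg _ _)) (apply_nonneg _ _)
  obtain ⟨z₀, hz₀⟩ := riggedDiamond_surjective hL ι U
  have hfour : IsGLB _ (fourNorm ι nE nF U) := Real.isGLB_sInf ⟨_, z₀, hz₀, rfl⟩ ⟨0, by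
    rintro _ ⟨z, -, rfl⟩
    refine (hproj z).2 ?_
    rintro _ ⟨n, x₁, x₂, x₃, x₄, -, rfl⟩
    exact Finset.sum_nonneg fun k _ => mul_nonneg (mul_nonneg (mul_nonneg (apply_nonneg _ _)
      (apply_nonneg _ _)) (apply_nonneg _ _)) (apply_nonneg _ _)⟩
  constructor
  · rintro _ ⟨n, b, d, u, v, rfl, rfl⟩
    refine (hfour.1 ⟨∑ k, b k ⊗ₜ[ℂ] (u k ⊗ₜ[ℂ] (v k ⊗ₜ[ℂ] d k)), ?_, rfl⟩).trans
      ((hproj _).1 ⟨n, b, u, v, d, rfl, rfl⟩)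
    simp only [map_sum, riggedDiamond_tmul]
  · intro l hl
    refine hfour.2 ?_
    rintro _ ⟨z, rfl, rfl⟩
    refine (hproj z).2 ?_
    rintro _ ⟨n, b, u, v, d, rfl, rfl⟩
    refine hl ⟨n, b, d, u, v, ?_, rfl⟩
    simp only [map_sum, riggedDiamond_tmul]

theorem fourNorm_sum_le (hL : ¬ FiniteDimensional ℂ L) {κ : Type*} [Fintype κ] (b d : κ → Cpt L)
    (u : κ → Ampl L E) (v : κ → Ampl L F) :
    fourNorm ι nE nF
        (∑ k, lact (b k : L →L[ℂ] L) (ract (d k : L →L[ℂ] L) (extDiamond ι (u k) (v k)))) ≤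
      ∑ k, ‖b k‖ * nE.norm (u k) * nF.norm (v k) * ‖d k‖ :=
  (isGLB_fourNorm hL _).1 (sum_mem_representationValues b d u v)

theorem fourNorm_lact_ract_extDiamond_le (hL : ¬ FiniteDimensional ℂ L) (b d : Cpt L)
    (u : Ampl L E) (v : Ampl L F) :
    fourNorm ι nE nF (lact (b : L →L[ℂ] L) (ract (d : L →L[ℂ] L) (extDiamond ι u v))) ≤
      ‖b‖ * nE.norm u * nF.norm v * ‖d‖ := by
  simpa using fourNorm_sum_le (ι := ι) (nE := nE) (nF := nF) hL (fun _ : Unit => b) (fun _ => d)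
    (fun _ => u) (fun _ => v)

theorem fourNorm_nonneg (hL : ¬ FiniteDimensional ℂ L) (U : Ampl L (E ⊗[ℂ] F)) :
    0 ≤ fourNorm ι nE nF U :=
  (isGLB_fourNorm hL U).2 fun _ => nonneg_of_mem_representationValues

/-- `‖·‖₄` is, up to constants, the largest subadditive function with a prescribed bound on the
elements `b · (u ⋄ v) · d`. -/
theorem le_mul_fourNorm (hL : ¬ FiniteDimensional ℂ L) {q : Ampl L (E ⊗[ℂ] F) → ℝ}
    (h0 : q 0 ≤ 0) (hadd : ∀ U V, q (U + V) ≤ q U + q V) {C : ℝ} (hC : 0 ≤ C)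
    (h : ∀ (b d : Cpt L) (u : Ampl L E) (v : Ampl L F),
      q (lact (b : L →L[ℂ] L) (ract (d : L →L[ℂ] L) (extDiamond ι u v))) ≤
        C * (‖b‖ * nE.norm u * nF.norm v * ‖d‖)) (U : Ampl L (E ⊗[ℂ] F)) :
    q U ≤ C * fourNorm ι nE nF U := by
  have key : ∀ r ∈ representationValues ι nE nF U, q U ≤ C * r := by
    rintro _ ⟨n, b, d, u, v, rfl, rfl⟩
    rw [Finset.mul_sum]
    exact (Finset.le_sum_of_subadditive q h0 hadd _ _).trans
      (Finset.sum_le_sum fun k _ => h _ _ _ _)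
  have hglb := isGLB_fourNorm (ι := ι) (nE := nE) (nF := nF) hL U
  rcases hC.eq_or_lt with rfl | hC
  · obtain ⟨r, hr⟩ := hglb.nonempty
    simpa using key r hr
  · rw [← div_le_iff₀' hC]
    exact hglb.2 fun r hr => (div_le_iff₀' hC).2 (key r hr)

theorem fourNorm_add_le (hL : ¬ FiniteDimensional ℂ L) (U V : Ampl L (E ⊗[ℂ] F)) :
    fourNorm ι nE nF (U + V) ≤ fourNorm ι nE nF U + fourNorm ι nE nF V := by
  have key : ∀ r ∈ representationValues ι nE nF U, ∀ s ∈ representationValues ι nE nF V,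
      fourNorm ι nE nF (U + V) ≤ r + s := by
    rintro _ ⟨n, b, d, u, v, rfl, rfl⟩ _ ⟨m, b', d', u', v', rfl, rfl⟩
    simpa using fourNorm_sum_le (ι := ι) (nE := nE) (nF := nF) hL (Sum.elim b b') (Sum.elim d d')
      (Sum.elim u u') (Sum.elim v v')
  have h1 : ∀ s ∈ representationValues ι nE nF V,
      fourNorm ι nE nF (U + V) - s ≤ fourNorm ι nE nF U := fun s hs =>
    (isGLB_fourNorm hL U).2 fun r hr => by linarith [key r hr s hs]
  have h2 : fourNorm ι nE nF (U + V) - fourNorm ι nE nF U ≤ fourNorm ι nE nF V :=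
    (isGLB_fourNorm hL V).2 fun s hs => by linarith [h1 s hs]
  linarith

theorem fourNorm_zero_le (hL : ¬ FiniteDimensional ℂ L) : fourNorm ι nE nF 0 ≤ 0 := by
  simpa using fourNorm_sum_le (ι := ι) (nE := nE) (nF := nF) hL (fun k : Empty => k.elim)
    (fun k => k.elim) (fun k => k.elim) (fun k => k.elim)

theorem fourNorm_map_le (hL : ¬ FiniteDimensional ℂ L)
    (T : Ampl L (E ⊗[ℂ] F) →ₗ[ℂ] Ampl L (E ⊗[ℂ] F)) {C : ℝ} (hC : 0 ≤ C)
    (h : ∀ (b d : Cpt L) (u : Ampl L E) (v : Ampl L F), fourNorm ι nE nF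
        (T (lact (b : L →L[ℂ] L) (ract (d : L →L[ℂ] L) (extDiamond ι u v)))) ≤
      C * (‖b‖ * nE.norm u * nF.norm v * ‖d‖)) (U : Ampl L (E ⊗[ℂ] F)) :
    fourNorm ι nE nF (T U) ≤ C * fourNorm ι nE nF U :=
  le_mul_fourNorm (q := fun U => fourNorm ι nE nF (T U)) hL
    (by simpa using fourNorm_zero_le hL)
    (fun U V => by simpa using fourNorm_add_le hL (T U) (T V)) hC h U

theorem norm_cptMulLeft_le (a : L →L[ℂ] L) (b : Cpt L) : ‖cptMulLeft a b‖ ≤ ‖a‖ * ‖b‖ :=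
  norm_mul_le a (b : L →L[ℂ] L)

theorem norm_cptMulRight_le (a : L →L[ℂ] L) (b : Cpt L) : ‖cptMulRight a b‖ ≤ ‖a‖ * ‖b‖ :=
  (norm_mul_le (b : L →L[ℂ] L) a).trans_eq (mul_comm _ _)

/-- `‖·‖₄` as a seminorm. -/
def fourSeminorm (hL : ¬ FiniteDimensional ℂ L) (ι : L ≃ₗᵢ[ℂ] HilbertTensor L L)
    (nE : QuantumNorm L E) (nF : QuantumNorm L F) : Seminorm ℂ (Ampl L (E ⊗[ℂ] F)) :=
  Seminorm.ofSMulLE (fourNorm ι nE nF)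
    (le_antisymm (fourNorm_zero_le hL) (fourNorm_nonneg hL 0)) (fourNorm_add_le hL) fun c U => by
      refine fourNorm_map_le hL (LinearMap.lsmul ℂ _ c) (norm_nonneg c) (fun b d u v => ?_) U
      have h := fourNorm_lact_ract_extDiamond_le (ι := ι) (nE := nE) (nF := nF) hL (c • b) d u v
      rw [norm_smul] at h
      have h' : lact ((c • b : Cpt L) : L →L[ℂ] L) = c • lact (E := E ⊗[ℂ] F) (b : L →L[ℂ] L) :=
        map_smul lact c (b : L →L[ℂ] L)
      rw [h'] at h
      refine h.trans_eq ?_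
      ring

theorem ruanOne_fourSeminorm (hL : ¬ FiniteDimensional ℂ L) :
    RuanOne (fourSeminorm hL ι nE nF) := by
  intro a U
  refine ⟨fourNorm_map_le hL (lact a) (norm_nonneg a) (fun b d u v => ?_) U,
    fourNorm_map_le hL (ract a) (norm_nonneg a) (fun b d u v => ?_) U⟩
  · rw [lact_lact]
    refine (fourNorm_lact_ract_extDiamond_le hL (cptMulLeft a b) d u v).trans ?_
    calc _ ≤ (‖a‖ * ‖b‖) * nE.norm u * nF.norm v * ‖d‖ := by
          gcongr
          exact norm_cptMulLeft_le a b
      _ = _ := by ring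
  · rw [ract_lact, ract_ract]
    refine (fourNorm_lact_ract_extDiamond_le hL b (cptMulRight a d) u v).trans ?_
    calc _ ≤ ‖b‖ * nE.norm u * nF.norm v * (‖a‖ * ‖d‖) := by
          refine mul_le_mul_of_nonneg_left (norm_cptMulRight_le a d) ?_
          exact mul_nonneg (mul_nonneg (norm_nonneg _) (apply_nonneg _ _)) (apply_nonneg _ _)
      _ = _ := by ring

end FourNorm

/-! ### Rows, columns and block diagonal elements -/

section OrthogonalFamilies

theorem sum_norm_apply_sq_le {L : Type*} [NormedAddCommGroup L] [InnerProductSpace ℂ L]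
    {κ : Type*} [Fintype κ] (c : κ → L →L[ℂ] L) {r : ℝ} (hc : ∑ k, ‖c k‖ ^ 2 ≤ r)
    (y : L) :
    ∑ k, ‖c k y‖ ^ 2 ≤ r * ‖y‖ ^ 2 := by
  refine (Finset.sum_le_sum fun k _ => ?_).trans
    ((Finset.sum_mul _ _ _).symm.trans_le (mul_le_mul_of_nonneg_right hc (sq_nonneg ‖y‖)))
  rw [← mul_pow]
  exact pow_le_pow_left₀ (norm_nonneg _) ((c k).le_opNorm y) 2

variable {L : Type*} [NormedAddCommGroup L] [InnerProductSpace ℂ L] [CompleteSpace L]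
variable {κ : Type*} [Fintype κ] [DecidableEq κ]

theorem norm_sum_orthogonal_isometries_sq {T : κ → L →L[ℂ] L}
    (hT : ∀ k l, star (T k) * T l = if k = l then 1 else 0) (y : κ → L) :
    ‖∑ k, T k (y k)‖ ^ 2 = ∑ k, ‖y k‖ ^ 2 := by
  have h : ∀ k l (x y : L), inner ℂ (T k x) (T l y) = if k = l then inner ℂ x y else 0 := by
    intro k l x y
    rw [← ContinuousLinearMap.adjoint_inner_right, ← ContinuousLinearMap.star_eq_adjoint,
      ← mul_apply_eq_comp, hT]
    split_ifs <;> simp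
  have h2 : inner ℂ (∑ k, T k (y k)) (∑ k, T k (y k)) = ∑ k, inner ℂ (y k) (y k) := by
    simp_rw [sum_inner, inner_sum, h]
    simp
  simp_rw [inner_self_eq_norm_sq_to_K] at h2
  exact_mod_cast h2

theorem norm_sq_add_norm_sq_le {P Q : L →L[ℂ] L} (hP : IsStarProjection P)
    (hQ : IsStarProjection Q) (hPQ : P * Q = 0) (x : L) : ‖P x‖ ^ 2 + ‖Q x‖ ^ 2 ≤ ‖x‖ ^ 2 := by
  have hself : ∀ {P : L →L[ℂ] L}, IsStarProjection P → inner ℂ x (P x) = ((‖P x‖ ^ 2 : ℝ) : ℂ) := by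
    intro P hP
    have h := inner_self_eq_norm_sq_to_K (𝕜 := ℂ) (P x)
    rw [← ContinuousLinearMap.adjoint_inner_right, ← ContinuousLinearMap.star_eq_adjoint,
      hP.isSelfAdjoint.star_eq, ← mul_apply_eq_comp, hP.isIdempotentElem.eq] at h
    rw [h]
    simp
  have h1 := hself hP
  have h2 := hself hQ
  have h3 : inner ℂ (P x) (Q x) = 0 := by
    rw [← ContinuousLinearMap.adjoint_inner_right, ← ContinuousLinearMap.star_eq_adjoint,
      hP.isSelfAdjoint.star_eq, ← mul_apply_eq_comp, hPQ]
    simp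
  have h4 : ‖x - (P x + Q x)‖ ^ 2 = ‖x‖ ^ 2 - (‖P x‖ ^ 2 + ‖Q x‖ ^ 2) := by
    rw [norm_sub_sq (𝕜 := ℂ), norm_add_sq (𝕜 := ℂ), inner_add_right, h1, h2, h3, map_add]
    simp only [RCLike.re_to_complex, Complex.ofReal_re, Complex.zero_re]
    ring
  nlinarith [sq_nonneg ‖x - (P x + Q x)‖]

/-- A column `∑ T_k c_k` along isometries with orthogonal ranges, whose entries live on two
orthogonal projections, has norm at most the larger of the norms of its two halves. -/
theorem norm_sum_mul_le_sqrt {α β : Type*} [Fintype α] [Fintype β] [DecidableEq α] [DecidableEq β]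
    {T : α ⊕ β → L →L[ℂ] L} (hT : ∀ k l, star (T k) * T l = if k = l then 1 else 0)
    {P Q : L →L[ℂ] L} (hP : IsStarProjection P) (hQ : IsStarProjection Q) (hPQ : P * Q = 0)
    (c : α → L →L[ℂ] L) (c' : β → L →L[ℂ] L) {r : ℝ} (hr : 0 ≤ r)
    (hc : ∑ k, ‖c k‖ ^ 2 ≤ r) (hc' : ∑ k, ‖c' k‖ ^ 2 ≤ r) :
    ‖∑ k, T k * Sum.elim (fun k => c k * P) (fun k => c' k * Q) k‖ ≤ √r := by
  refine ContinuousLinearMap.opNorm_le_bound _ (Real.sqrt_nonneg r) fun x => ?_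
  have h := norm_sum_orthogonal_isometries_sq hT
    fun k => Sum.elim (fun k => c k * P) (fun k => c' k * Q) k x
  have hsum : (∑ k, T k * Sum.elim (fun k => c k * P) (fun k => c' k * Q) k) x =
      ∑ k, T k (Sum.elim (fun k => c k * P) (fun k => c' k * Q) k x) := by
    rw [_root_.sum_apply]
    rfl
  rw [hsum]
  refine le_of_sq_le_sq ?_ (by positivity)
  rw [h, mul_pow, Real.sq_sqrt hr, Fintype.sum_sum_type]
  refine (add_le_add (sum_norm_apply_sq_le c hc (P x)) (sum_norm_apply_sq_le c' hc' (Q x))).trans ?_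
  calc _ = r * (‖P x‖ ^ 2 + ‖Q x‖ ^ 2) := by ring
    _ ≤ _ := mul_le_mul_of_nonneg_left (norm_sq_add_norm_sq_le hP hQ hPQ x) hr

variable {E : Type*} [AddCommGroup E] [Module ℂ E]

theorem QuantumNorm.norm_zero (n : QuantumNorm L E) : n.norm 0 = 0 :=
  n.norm.map_zero'

/-- A block diagonal element `∑ J_k · u_k · J_k*` has norm at most the largest of the norms of its
blocks. -/
theorem norm_sum_blocks_le (n : QuantumNorm L E) {J : κ → L →L[ℂ] L}
    (hJ : ∀ k l, star (J k) * J l = if k = l then 1 else 0) (u : κ → Ampl L E) {C : ℝ}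
    (hC : 0 ≤ C) (hu : ∀ k, n.norm (u k) ≤ C) :
    n.norm (∑ k, lact (J k) (ract (star (J k)) (u k))) ≤ C := by
  have hPJ : ∀ k l, J k * star (J k) * J l = if k = l then J l else 0 := by
    intro k l
    rw [mul_assoc, hJ]
    split_ifs with h
    · rw [h, mul_one]
    · rw [mul_zero]
  have hJP : ∀ k l, star (J l) * (J k * star (J k)) = if k = l then star (J l) else 0 := by
    intro k l
    rw [← mul_assoc, hJ]
    simp_rw [eq_comm (a := l)]
    split_ifs with h
    · rw [h, one_mul]
    · rw [zero_mul]
  have hsupp : ∀ s : Finset κ, IsSupport (∑ k ∈ s, J k * star (J k))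
      (∑ k ∈ s, lact (J k) (ract (star (J k)) (u k))) := by
    intro s
    refine ⟨⟨?_, ?_⟩, ?_, ?_⟩
    · rw [IsIdempotentElem, Finset.mul_sum]
      refine Finset.sum_congr rfl fun k hk => ?_
      simp_rw [Finset.sum_mul, ← mul_assoc, hPJ, ite_mul, zero_mul]
      rw [Finset.sum_ite_eq' s k, if_pos hk]
    · rw [isSelfAdjoint_iff, star_sum]
      simp_rw [star_mul, star_star]
    · rw [map_sum]
      refine Finset.sum_congr rfl fun k hk => ?_
      rw [lact_lact, Finset.sum_mul]
      simp_rw [hPJ]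
      rw [Finset.sum_ite_eq' s k, if_pos hk]
    · rw [map_sum]
      refine Finset.sum_congr rfl fun k hk => ?_
      rw [ract_lact, ract_ract, Finset.mul_sum]
      simp_rw [hJP]
      rw [Finset.sum_ite_eq' s k, if_pos hk]
  have hone : ∀ k, n.norm (lact (J k) (ract (star (J k)) (u k))) ≤ C := by
    intro k
    have h1 : ‖J k‖ ≤ 1 := norm_le_one_of_star_mul_self (by rw [hJ, if_pos rfl])
    refine ((n.ruanOne _ _).1.trans (mul_le_of_le_one_left (apply_nonneg _ _) h1)).trans
      (((n.ruanOne _ _).2.trans (mul_le_of_le_one_left (apply_nonneg _ _) ?_)).trans (hu k))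
    rwa [norm_star]
  have key : ∀ s : Finset κ, n.norm (∑ k ∈ s, lact (J k) (ract (star (J k)) (u k))) ≤ C := by
    intro s
    induction s using Finset.induction_on with
    | empty => exact n.norm_zero.trans_le hC
    | insert k s hk ih =>
      rw [Finset.sum_insert hk]
      have h1 := hsupp {k}
      rw [Finset.sum_singleton, Finset.sum_singleton] at h1
      rw [n.ruanTwo _ _ _ _ h1 (hsupp s)]
      · exact max_le (hone k) ih
      · rw [Finset.mul_sum]
        refine Finset.sum_eq_zero fun l hl => ?_
        rw [← mul_assoc, hPJ, if_neg (by rintro rfl; exact hk hl), zero_mul]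
  exact key Finset.univ

end OrthogonalFamilies

/-! ### The second axiom of Ruan -/

section RuanTwo

variable {L : Type*} [NormedAddCommGroup L] [InnerProductSpace ℂ L] [CompleteSpace L]
variable {E : Type*} [AddCommGroup E] [Module ℂ E] {F : Type*} [AddCommGroup F] [Module ℂ F]
variable {ι : L ≃ₗᵢ[ℂ] HilbertTensor L L} {nE : QuantumNorm L E} {nF : QuantumNorm L F}

/-- Compression of a sum to a single term: with `T_k = J_k ⋄ J_k`, the sum
`∑ b_k · (u_k ⋄ v_k) · d_k` equals `b · (u ⋄ v) · d`, where `u` and `v` are block diagonal with blocks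
`u_k` and `v_k`, `b = ∑ b_k T_k*` is a row and `d = ∑ T_k d_k` is a column. -/
theorem lact_ract_extDiamond_blocks {κ : Type*} [Fintype κ] [DecidableEq κ] {J : κ → L →L[ℂ] L}
    (hJ : ∀ k l, star (J k) * J l = if k = l then 1 else 0) (b d : κ → L →L[ℂ] L)
    (u : κ → Ampl L E) (v : κ → Ampl L F) :
    lact (∑ k, b k * star (diamond ι (J k) (J k))) (ract (∑ k, diamond ι (J k) (J k) * d k)
      (extDiamond ι (∑ k, lact (J k) (ract (star (J k)) (u k)))
        (∑ k, lact (J k) (ract (star (J k)) (v k))))) =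
    ∑ k, lact (b k) (ract (d k) (extDiamond ι (u k) (v k))) := by
  have hb : ∀ i j, (∑ k, b k * star (diamond ι (J k) (J k))) * diamond ι (J i) (J j) =
      if i = j then b i else 0 := by
    intro i j
    rw [Finset.sum_mul, Finset.sum_eq_single i]
    · rw [star_diamond, mul_assoc, ← diamond_mul, hJ, hJ, if_pos rfl]
      split_ifs
      · rw [diamond_one, mul_one]
      · rw [diamond_zero_right, mul_zero]
    · intro k _ hk
      rw [star_diamond, mul_assoc, ← diamond_mul, hJ, if_neg hk, diamond_zero_left, mul_zero]
    · simp
  have hd : ∀ i j, diamond ι (star (J i)) (star (J j)) * (∑ k, diamond ι (J k) (J k) * d k) =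
      if i = j then d i else 0 := by
    intro i j
    rw [Finset.mul_sum, Finset.sum_eq_single i]
    · rw [← mul_assoc, ← diamond_mul, hJ, hJ, if_pos rfl]
      simp_rw [eq_comm (a := j)]
      split_ifs
      · rw [diamond_one, one_mul]
      · rw [diamond_zero_right, zero_mul]
    · intro k _ hk
      rw [← mul_assoc, ← diamond_mul, hJ, if_neg hk.symm, diamond_zero_left, zero_mul]
    · simp
  generalize (∑ k, b k * star (diamond ι (J k) (J k))) = β at hb ⊢
  generalize (∑ k, diamond ι (J k) (J k) * d k) = δ at hd ⊢
  have h : ∀ i j, lact β (ract δ (extDiamond ι (lact (J i) (ract (star (J i)) (u i)))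
      (lact (J j) (ract (star (J j)) (v j))))) =
      if i = j then lact (b i) (ract (d i) (extDiamond ι (u i) (v i))) else 0 := by
    intro i j
    rw [extDiamond_lact, extDiamond_ract, ract_lact, lact_lact, ract_ract, hb, hd]
    split_ifs with hij
    · rw [hij]
    · rw [map_zero, LinearMap.zero_apply]
  rw [map_sum, map_sum, map_sum]
  refine Finset.sum_congr rfl fun j _ => ?_
  rw [map_sum, LinearMap.sum_apply, map_sum, map_sum]
  simp_rw [h]
  simp

/-- A representation of value less than `r` can be rescaled so that `‖u_k‖, ‖v_k‖ ≤ 1` and each of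
`‖b_k‖²`, `‖d_k‖²` is at most the value of the `k`-th term. -/
theorem exists_normalized_representation (hL : ¬ FiniteDimensional ℂ L) {U : Ampl L (E ⊗[ℂ] F)}
    {r : ℝ} (hr : fourNorm ι nE nF U < r) :
    ∃ (n : ℕ) (b d : Fin n → Cpt L) (u : Fin n → Ampl L E) (v : Fin n → Ampl L F),
      U = ∑ k, lact (b k : L →L[ℂ] L) (ract (d k : L →L[ℂ] L) (extDiamond ι (u k) (v k))) ∧
      (∀ k, nE.norm (u k) ≤ 1) ∧ (∀ k, nF.norm (v k) ≤ 1) ∧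
      ∑ k, ‖(b k : L →L[ℂ] L)‖ ^ 2 ≤ r ∧ ∑ k, ‖(d k : L →L[ℂ] L)‖ ^ 2 ≤ r := by
  obtain ⟨s, ⟨n, b, d, u, v, rfl, rfl⟩, -, hs⟩ := (isGLB_fourNorm hL U).exists_between hr
  have hterm : ∀ k, ∃ (b' d' : Cpt L) (u' : Ampl L E) (v' : Ampl L F),
      lact (b k : L →L[ℂ] L) (ract (d k : L →L[ℂ] L) (extDiamond ι (u k) (v k))) =
        lact (b' : L →L[ℂ] L) (ract (d' : L →L[ℂ] L) (extDiamond ι u' v')) ∧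
      nE.norm u' ≤ 1 ∧ nF.norm v' ≤ 1 ∧
      ‖b'‖ ^ 2 ≤ ‖b k‖ * nE.norm (u k) * nF.norm (v k) * ‖d k‖ ∧
      ‖d'‖ ^ 2 ≤ ‖b k‖ * nE.norm (u k) * nF.norm (v k) * ‖d k‖ := by
    intro k
    -- If the value of a term vanishes, one of its four factors is zero and so is the term.
    by_cases h0 : ‖b k‖ * nE.norm (u k) * nF.norm (v k) * ‖d k‖ = 0
    · refine ⟨0, 0, 0, 0, ?_, nE.norm_zero.trans_le zero_le_one, nF.norm_zero.trans_le zero_le_one,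
        by rw [h0]; simp, by rw [h0]; simp⟩
      simp only [mul_eq_zero, norm_eq_zero] at h0
      rcases h0 with ((h | h) | h) | h
      · simp [h]
      · simp [nE.eq_zero_of_norm_eq_zero _ h]
      · simp [nF.eq_zero_of_norm_eq_zero _ h]
      · simp [h]
    · set ρ := ‖b k‖ * nE.norm (u k) * nF.norm (v k) * ‖d k‖ with hρ
      have hρ0 : 0 ≤ ρ := by
        rw [hρ]
        have h1 := apply_nonneg nE.norm (u k)
        have h2 := apply_nonneg nF.norm (v k)
        positivity
      have hb : ‖b k‖ ≠ 0 := fun h => h0 (by rw [hρ, h]; ring)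
      have hu : nE.norm (u k) ≠ 0 := fun h => h0 (by rw [hρ, h]; ring)
      have hv : nF.norm (v k) ≠ 0 := fun h => h0 (by rw [hρ, h]; ring)
      have hd : ‖d k‖ ≠ 0 := fun h => h0 (by rw [hρ, h]; ring)
      refine ⟨((√ρ / ‖b k‖ : ℝ) : ℂ) • b k, ((√ρ / ‖d k‖ : ℝ) : ℂ) • d k,
        (((nE.norm (u k))⁻¹ : ℝ) : ℂ) • u k, (((nF.norm (v k))⁻¹ : ℝ) : ℂ) • v k, ?_, ?_, ?_, ?_, ?_⟩
      · have h1 : √ρ / ‖b k‖ * (√ρ / ‖d k‖) * ((nE.norm (u k))⁻¹ * (nF.norm (v k))⁻¹) = 1 := by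
          have h2 : √ρ * √ρ = ρ := Real.mul_self_sqrt hρ0
          field_simp
          rw [sq, h2, hρ]
          ring
        generalize √ρ / ‖b k‖ = s₁ at h1 ⊢
        generalize √ρ / ‖d k‖ = s₂ at h1 ⊢
        generalize (nE.norm (u k))⁻¹ = s₃ at h1 ⊢
        generalize (nF.norm (v k))⁻¹ = s₄ at h1 ⊢
        simp only [Submodule.coe_smul, map_smul, LinearMap.smul_apply, smul_smul]
        rw [show (s₄ * s₃ * s₂ * s₁ : ℂ) = ((s₁ * s₂ * (s₃ * s₄) : ℝ) : ℂ) by push_cast; ring,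
          h1, Complex.ofReal_one, one_smul]
      · rw [map_smul_eq_mul, Complex.norm_real, norm_inv, Real.norm_of_nonneg (apply_nonneg _ _),
          inv_mul_cancel₀ hu]
      · rw [map_smul_eq_mul, Complex.norm_real, norm_inv, Real.norm_of_nonneg (apply_nonneg _ _),
          inv_mul_cancel₀ hv]
      · rw [norm_smul, Complex.norm_real, Real.norm_of_nonneg (by positivity), div_mul_cancel₀ _ hb,
          Real.sq_sqrt hρ0]
      · rw [norm_smul, Complex.norm_real, Real.norm_of_nonneg (by positivity), div_mul_cancel₀ _ hd,
          Real.sq_sqrt hρ0]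
  choose b' d' u' v' h hu hv hb hd using hterm
  exact ⟨n, b', d', u', v', Finset.sum_congr rfl fun k _ => h k, hu, hv,
    (Finset.sum_le_sum fun k _ => hb k).trans hs.le, (Finset.sum_le_sum fun k _ => hd k).trans hs.le⟩

theorem exists_orthogonal_isometries_fintype (hL : ¬ FiniteDimensional ℂ L)
    (ι : L ≃ₗᵢ[ℂ] HilbertTensor L L) (κ : Type*) [Fintype κ] [DecidableEq κ] :
    ∃ J : κ → L →L[ℂ] L, ∀ k l, star (J k) * J l = if k = l then 1 else 0 := by
  obtain ⟨J, hJ⟩ := exists_orthogonal_isometries hL ι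
  refine ⟨fun k => J (Fintype.equivFin κ k), fun k l => ?_⟩
  simp [hJ, Fin.val_inj]

/-- The half of the second axiom of Ruan that uses the shape of `‖·‖₄`: both elements are compressed
to a single term `b · (u ⋄ v) · d`, in which the row `b` and the column `d` have orthogonal halves. -/
theorem fourNorm_add_le_of_isSupport (hL : ¬ FiniteDimensional ℂ L) {P Q : L →L[ℂ] L}
    {U V : Ampl L (E ⊗[ℂ] F)} (hU : IsSupport P U) (hV : IsSupport Q V) (hPQ : P * Q = 0) :
    fourNorm ι nE nF (U + V) ≤ max (fourNorm ι nE nF U) (fourNorm ι nE nF V) := by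
  refine le_of_forall_gt_imp_ge_of_dense fun r hr => ?_
  have hr0 : 0 ≤ r := (fourNorm_nonneg hL U).trans ((le_max_left _ _).trans hr.le)
  obtain ⟨n, b, d, u, v, hU', hu, hv, hb, hd⟩ :=
    exists_normalized_representation hL ((le_max_left _ _).trans_lt hr)
  obtain ⟨m, b', d', u', v', hV', hu', hv', hb', hd'⟩ :=
    exists_normalized_representation hL ((le_max_right _ _).trans_lt hr)
  obtain ⟨J, hJ⟩ := exists_orthogonal_isometries_fintype hL ι (Fin n ⊕ Fin m)
  have hT : ∀ k l, star (diamond ι (J k) (J k)) * diamond ι (J l) (J l) =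
      if k = l then 1 else 0 := by
    intro k l
    rw [star_diamond, ← diamond_mul, hJ]
    split_ifs
    · exact diamond_one ι
    · exact diamond_zero_left ι _
  -- The representations of `U` and `V`, cut down by the supports.
  let B : Fin n ⊕ Fin m → Cpt L :=
    Sum.elim (fun k => cptMulLeft P (b k)) (fun k => cptMulLeft Q (b' k))
  let D : Fin n ⊕ Fin m → Cpt L :=
    Sum.elim (fun k => cptMulRight P (d k)) (fun k => cptMulRight Q (d' k))
  have hsum : U + V = ∑ k, lact (B k : L →L[ℂ] L) (ract (D k : L →L[ℂ] L)
      (extDiamond ι (Sum.elim u u' k) (Sum.elim v v' k))) := by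
    rw [Fintype.sum_sum_type]
    have hcut : ∀ {l : ℕ} {P : L →L[ℂ] L} {U : Ampl L (E ⊗[ℂ] F)} (b d : Fin l → Cpt L)
        (u : Fin l → Ampl L E) (v : Fin l → Ampl L F), IsSupport P U →
        U = ∑ k, lact (b k : L →L[ℂ] L) (ract (d k : L →L[ℂ] L) (extDiamond ι (u k) (v k))) →
        U = ∑ k, lact (P * (b k : L →L[ℂ] L)) (ract ((d k : L →L[ℂ] L) * P)
          (extDiamond ι (u k) (v k))) := by
      intro l P U b d u v hU h
      rw [← hU.2.1, ← hU.2.2, h]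
      simp only [map_sum, ract_lact, lact_lact, ract_ract]
    exact congrArg₂ (· + ·) (hcut b d u v hU hU') (hcut b' d' u' v' hV hV')
  let β : Cpt L := ∑ k, cptMulRight (star (diamond ι (J k) (J k))) (B k)
  let δ : Cpt L := ∑ k, cptMulLeft (diamond ι (J k) (J k)) (D k)
  have hβ : (β : L →L[ℂ] L) = ∑ k, (B k : L →L[ℂ] L) * star (diamond ι (J k) (J k)) := by
    rw [Submodule.coe_sum]
    rfl
  have hδ : (δ : L →L[ℂ] L) = ∑ k, diamond ι (J k) (J k) * (D k : L →L[ℂ] L) := by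
    rw [Submodule.coe_sum]
    rfl
  have hβn : ‖β‖ ≤ √r := by
    have h : star (β : L →L[ℂ] L) = ∑ k, diamond ι (J k) (J k) *
        Sum.elim (fun k => star (b k : L →L[ℂ] L) * P) (fun k => star (b' k : L →L[ℂ] L) * Q) k := by
      rw [hβ, star_sum]
      refine Finset.sum_congr rfl fun k _ => ?_
      rw [star_mul, star_star]
      congr 1
      rcases k with k | k
      · exact (star_mul P (b k : L →L[ℂ] L)).trans (by rw [hU.1.isSelfAdjoint.star_eq]; rfl)
      · exact (star_mul Q (b' k : L →L[ℂ] L)).trans (by rw [hV.1.isSelfAdjoint.star_eq]; rfl)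
    rw [Submodule.coe_norm, ← norm_star, h]
    exact norm_sum_mul_le_sqrt hT hU.1 hV.1 hPQ _ _ hr0 (by simpa only [norm_star] using hb)
      (by simpa only [norm_star] using hb')
  have hδn : ‖δ‖ ≤ √r := by
    have h : (δ : L →L[ℂ] L) = ∑ k, diamond ι (J k) (J k) *
        Sum.elim (fun k => (d k : L →L[ℂ] L) * P) (fun k => (d' k : L →L[ℂ] L) * Q) k := by
      rw [hδ]
      refine Finset.sum_congr rfl fun k _ => ?_
      rcases k with k | k <;> rfl
    rw [Submodule.coe_norm, h]
    exact norm_sum_mul_le_sqrt hT hU.1 hV.1 hPQ _ _ hr0 hd hd'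
  rw [hsum, ← lact_ract_extDiamond_blocks hJ, ← hβ, ← hδ]
  refine (fourNorm_lact_ract_extDiamond_le hL β δ _ _).trans ?_
  have h1 := norm_sum_blocks_le nE hJ (Sum.elim u u') zero_le_one
    (by rintro (k | k); exacts [hu k, hu' k])
  have h2 := norm_sum_blocks_le nF hJ (Sum.elim v v') zero_le_one
    (by rintro (k | k); exacts [hv k, hv' k])
  calc _ ≤ √r * 1 * 1 * √r := by
        gcongr
    _ = r := by rw [mul_one, mul_one, Real.mul_self_sqrt hr0]

theorem ruanTwo_fourSeminorm (hL : ¬ FiniteDimensional ℂ L) :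
    RuanTwo (fourSeminorm hL ι nE nF) := by
  intro P Q U V hU hV hPQ
  refine le_antisymm (fourNorm_add_le_of_isSupport hL hU hV hPQ) ?_
  have hcomp : ∀ {P Q : L →L[ℂ] L} {U V : Ampl L (E ⊗[ℂ] F)}, IsSupport P U → IsSupport Q V →
      P * Q = 0 → fourSeminorm hL ι nE nF U ≤ fourSeminorm hL ι nE nF (U + V) := by
    intro P Q U V hU hV hPQ
    have h0 : lact P V = 0 := by rw [← hV.2.1, lact_lact, hPQ, map_zero, LinearMap.zero_apply]
    have hP1 : ‖P‖ ≤ 1 := hU.1.norm_le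
    have h := (ruanOne_fourSeminorm (ι := ι) (nE := nE) (nF := nF) hL P (U + V)).1
    rw [map_add, h0, add_zero, hU.2.1] at h
    exact h.trans (mul_le_of_le_one_left (apply_nonneg _ _) hP1)
  have hQP : Q * P = 0 := by
    rw [← hU.1.isSelfAdjoint.star_eq, ← hV.1.isSelfAdjoint.star_eq, ← star_mul, hPQ, star_zero]
  exact max_le (hcomp hU hV hPQ) (by rw [add_comm]; exact hcomp hV hU hQP)

end RuanTwo

/-! ### Slices by bounded functionals and definiteness -/

section Functionals

open InnerProductSpace

/-- The slice map `w ⊗ x ↦ f(x) w` of a linear functional `f`. -/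
def slice (W : Type*) [AddCommGroup W] [Module ℂ W] {E : Type*} [AddCommGroup E] [Module ℂ E]
    (f : E →ₗ[ℂ] ℂ) : W ⊗[ℂ] E →ₗ[ℂ] W :=
  (TensorProduct.rid ℂ W).toLinearMap ∘ₗ f.lTensor W

theorem slice_tmul {W : Type*} [AddCommGroup W] [Module ℂ W] {E : Type*} [AddCommGroup E]
    [Module ℂ E] (f : E →ₗ[ℂ] ℂ) (w : W) (x : E) : slice W f (w ⊗ₜ x) = f x • w := by
  simp [slice]

/-- Slices by a separating set of functionals separate the points of a tensor product. -/
theorem eq_zero_of_forall_slice_eq_zero {W : Type*} [AddCommGroup W] [Module ℂ W] {E : Type*}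
    [AddCommGroup E] [Module ℂ E] {Φ : Set (E →ₗ[ℂ] ℂ)} (hΦ : ∀ x, (∀ f ∈ Φ, f x = 0) → x = 0)
    {z : W ⊗[ℂ] E} (hz : ∀ f ∈ Φ, slice W f z = 0) : z = 0 := by
  classical
  let B := Module.Basis.ofVectorSpace ℂ W
  apply (TensorProduct.equivFinsuppOfBasisLeft (N := E) B).injective
  rw [map_zero]
  ext i
  refine hΦ _ fun f hf => ?_
  have h : ∀ z : W ⊗[ℂ] E,
      f (TensorProduct.equivFinsuppOfBasisLeft B z i) = B.repr (slice W f z) i := by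
    intro z
    induction z using TensorProduct.induction_on with
    | zero => simp
    | add z w hz hw => simp only [map_add, Finsupp.add_apply, hz, hw]
    | tmul w x => simp [slice_tmul, mul_comm]
  rw [h, hz f hf, map_zero, Finsupp.zero_apply]

/-- The Hahn–Banach theorem for a seminorm. -/
theorem exists_functional_le_seminorm {E : Type*} [AddCommGroup E] [Module ℂ E] (p : Seminorm ℂ E)
    {x : E} (hx : p x ≠ 0) : ∃ f : E →ₗ[ℂ] ℂ, (∀ y, ‖f y‖ ≤ p y) ∧ f x ≠ 0 := by
  let : SeminormedAddCommGroup E := p.toAddGroupSeminorm.toSeminormedAddCommGroup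
  let : NormedSpace ℂ E := ⟨fun c y => (map_smul_eq_mul p c y).le⟩
  obtain ⟨g, hg, hgx⟩ := exists_dual_vector ℂ x hx
  refine ⟨g.toLinearMap, fun y => (g.le_opNorm y).trans_eq (by rw [hg, one_mul]; rfl), ?_⟩
  change g x ≠ 0
  rw [hgx]
  exact Complex.ofReal_ne_zero.2 hx

variable {L : Type*} [NormedAddCommGroup L] [InnerProductSpace ℂ L]
variable {E : Type*} [AddCommGroup E] [Module ℂ E] {F : Type*} [AddCommGroup F] [Module ℂ F]

theorem slice_lact (f : E →ₗ[ℂ] ℂ) (a : L →L[ℂ] L) (u : Ampl L E) :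
    slice (Cpt L) f (lact a u) = cptMulLeft a (slice (Cpt L) f u) := by
  induction u using TensorProduct.induction_on with
  | zero => simp
  | tmul c x => rw [lact_tmul, slice_tmul, slice_tmul, map_smul]
  | add u v hu hv => simp only [map_add, hu, hv]

theorem slice_ract (f : E →ₗ[ℂ] ℂ) (a : L →L[ℂ] L) (u : Ampl L E) :
    slice (Cpt L) f (ract a u) = cptMulRight a (slice (Cpt L) f u) := by
  induction u using TensorProduct.induction_on with
  | zero => simp
  | tmul c x => rw [ract_tmul, slice_tmul, slice_tmul, map_smul]
  | add u v hu hv => simp only [map_add, hu, hv]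

/-- The product functional `f ⊗ g` on `E ⊗ F`. -/
def prodFunctional (f : E →ₗ[ℂ] ℂ) (g : F →ₗ[ℂ] ℂ) : E ⊗[ℂ] F →ₗ[ℂ] ℂ :=
  TensorProduct.lift ((LinearMap.mul ℂ ℂ).compl₁₂ f g)

theorem prodFunctional_tmul (f : E →ₗ[ℂ] ℂ) (g : F →ₗ[ℂ] ℂ) (x : E) (y : F) :
    prodFunctional f g (x ⊗ₜ y) = f x * g y := rfl

theorem slice_extDiamond (ι : L ≃ₗᵢ[ℂ] HilbertTensor L L) (f : E →ₗ[ℂ] ℂ) (g : F →ₗ[ℂ] ℂ)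
    (u : Ampl L E) (v : Ampl L F) :
    slice (Cpt L) (prodFunctional f g) (extDiamond ι u v) =
      cptDiamond ι (slice (Cpt L) f u) (slice (Cpt L) g v) := by
  induction u using TensorProduct.induction_on with
  | zero => simp
  | add u u' hu hu' => simp only [map_add, LinearMap.add_apply, hu, hu']
  | tmul c x =>
    induction v using TensorProduct.induction_on with
    | zero => simp
    | add v v' hv hv' => simp only [map_add, hv, hv']
    | tmul d y =>
      rw [extDiamond, weakAmplify_tmul, slice_tmul, slice_tmul, slice_tmul, TensorProduct.mk_apply,
        prodFunctional_tmul, map_smul, map_smul, LinearMap.smul_apply, smul_smul, mul_comm]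

theorem slice_slice_assoc (f : E →ₗ[ℂ] ℂ) (g : F →ₗ[ℂ] ℂ) {W : Type*} [AddCommGroup W] [Module ℂ W]
    (z : W ⊗[ℂ] (E ⊗[ℂ] F)) :
    slice W f (slice (W ⊗[ℂ] E) g ((TensorProduct.assoc ℂ W E F).symm z)) =
      slice W (prodFunctional f g) z := by
  induction z using TensorProduct.induction_on with
  | zero => simp
  | add z w hz hw => simp only [map_add, hz, hw]
  | tmul w z =>
    induction z using TensorProduct.induction_on with
    | zero => simp
    | add z w hz hw => simp only [map_add, TensorProduct.tmul_add, hz, hw]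
    | tmul x y =>
      rw [TensorProduct.assoc_symm_tmul, slice_tmul, map_smul, slice_tmul, slice_tmul,
        prodFunctional_tmul, smul_smul, mul_comm]

variable [CompleteSpace L]

/-- The norm `x ↦ ‖p x‖` on a quantum space `E`, where `p` is the projection onto the line of the
unit vector `e`. -/
def QuantumNorm.baseNorm (n : QuantumNorm L E) (e : L) : Seminorm ℂ E :=
  n.norm.comp (TensorProduct.mk ℂ (Cpt L) E (cptRankOne e))

theorem QuantumNorm.baseNorm_ne_zero (n : QuantumNorm L E) {e : L} (he : ‖e‖ = 1) {x : E}
    (hx : x ≠ 0) : n.baseNorm e x ≠ 0 := by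
  intro h
  have h1 : (cptRankOne e ⊗ₜ x : Ampl L E) = 0 := n.eq_zero_of_norm_eq_zero _ h
  refine hx ((Module.forall_dual_apply_eq_zero_iff ℂ x).1 fun g => ?_)
  have h2 : g x • cptRankOne e = 0 :=
    (slice_tmul g (cptRankOne e) x).symm.trans (by rw [h1, map_zero])
  refine (smul_eq_zero.1 h2).resolve_right fun h3 => ?_
  have h4 : ‖(cptRankOne e : L →L[ℂ] L)‖ = 1 := by simp [cptRankOne, he]
  simp [h3] at h4

theorem QuantumNorm.eq_zero_of_forall_functional (n : QuantumNorm L E) {e : L} (he : ‖e‖ = 1)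
    (x : E) (h : ∀ f ∈ {f : E →ₗ[ℂ] ℂ | ∀ x, ‖f x‖ ≤ n.baseNorm e x}, f x = 0) : x = 0 := by
  by_contra hx
  obtain ⟨f, hf, hfx⟩ := exists_functional_le_seminorm _ (n.baseNorm_ne_zero he hx)
  exact hfx (h f hf)

/-- A functional bounded for the norm of `E` is completely bounded, in the form needed here: its
slice map `𝒦E → 𝒦` is bounded. A matrix coefficient `⟨η, f_∞(u) ξ⟩` is the value of `f` at a vector
`x` with `p x = (e ⊗ η*) · u · (ξ ⊗ e*)`. -/
theorem norm_slice_le (n : QuantumNorm L E) {e : L} (he : ‖e‖ = 1) {f : E →ₗ[ℂ] ℂ}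
    (hf : ∀ x, ‖f x‖ ≤ n.baseNorm e x) (u : Ampl L E) : ‖slice (Cpt L) f u‖ ≤ n.norm u := by
  have hcoef : ∀ η ξ : L, ∃ x : E,
      lact (rankOne ℂ e η) (ract (rankOne ℂ ξ e) u) = cptRankOne e ⊗ₜ x ∧
      f x = inner ℂ η ((slice (Cpt L) f u : L →L[ℂ] L) ξ) := by
    intro η ξ
    induction u using TensorProduct.induction_on with
    | zero => exact ⟨0, by simp, by simp⟩
    | add u v hu hv =>
      obtain ⟨x, hx, hx'⟩ := hu
      obtain ⟨y, hy, hy'⟩ := hv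
      refine ⟨x + y, by rw [map_add, map_add, hx, hy, TensorProduct.tmul_add], ?_⟩
      rw [map_add, map_add, hx', hy', Submodule.coe_add, _root_.add_apply, inner_add_right]
    | tmul c x =>
      refine ⟨inner ℂ η ((c : L →L[ℂ] L) ξ) • x, ?_, ?_⟩
      · rw [ract_tmul, lact_tmul, TensorProduct.tmul_smul, TensorProduct.smul_tmul']
        congr 1
        apply Subtype.ext
        change rankOne ℂ e η * ((c : L →L[ℂ] L) * rankOne ℂ ξ e) = _ • rankOne ℂ e e
        ext y
        simp [smul_smul, mul_comm]
      · rw [slice_tmul, map_smul, Submodule.coe_smul, _root_.smul_apply, inner_smul_right,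
          smul_eq_mul, mul_comm]
  refine ContinuousLinearMap.opNorm_le_bound _ (apply_nonneg _ _) fun ξ => ?_
  set η := (slice (Cpt L) f u : L →L[ℂ] L) ξ with hη
  obtain ⟨x, hx, hfx⟩ := hcoef η ξ
  have h1 : ‖η‖ * ‖η‖ ≤ n.norm u * ‖ξ‖ * ‖η‖ := by
    calc ‖η‖ * ‖η‖ = ‖f x‖ := by rw [hfx, ← hη, inner_self_eq_norm_sq_to_K]; simp [sq]
      _ ≤ n.norm (lact (rankOne ℂ e η) (ract (rankOne ℂ ξ e) u)) := by rw [hx]; exact hf x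
      _ ≤ ‖rankOne ℂ e η‖ * (‖rankOne ℂ ξ e‖ * n.norm u) :=
        (n.ruanOne _ _).1.trans
          (mul_le_mul_of_nonneg_left (n.ruanOne _ _).2 (norm_nonneg _))
      _ = _ := by rw [norm_rankOne, norm_rankOne, he]; ring
  rcases (norm_nonneg η).eq_or_lt with h0 | h0
  · change ‖η‖ ≤ _
    rw [← h0]
    exact mul_nonneg (apply_nonneg _ _) (norm_nonneg _)
  · exact le_of_mul_le_mul_right h1 h0

variable {ι : L ≃ₗᵢ[ℂ] HilbertTensor L L} {nE : QuantumNorm L E} {nF : QuantumNorm L F}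

theorem norm_slice_prodFunctional_le (hL : ¬ FiniteDimensional ℂ L) {e : L} (he : ‖e‖ = 1)
    {f : E →ₗ[ℂ] ℂ} (hf : ∀ x, ‖f x‖ ≤ nE.baseNorm e x) {g : F →ₗ[ℂ] ℂ}
    (hg : ∀ y, ‖g y‖ ≤ nF.baseNorm e y) (U : Ampl L (E ⊗[ℂ] F)) :
    ‖slice (Cpt L) (prodFunctional f g) U‖ ≤ fourNorm ι nE nF U := by
  have hterm : ∀ (b d : Cpt L) (u : Ampl L E) (v : Ampl L F),
      ‖slice (Cpt L) (prodFunctional f g)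
        (lact (b : L →L[ℂ] L) (ract (d : L →L[ℂ] L) (extDiamond ι u v)))‖ ≤
      1 * (‖b‖ * nE.norm u * nF.norm v * ‖d‖) := by
    intro b d u v
    rw [slice_lact, slice_ract, slice_extDiamond, one_mul]
    have h1 : ‖cptDiamond ι (slice (Cpt L) f u) (slice (Cpt L) g v)‖ ≤ nE.norm u * nF.norm v :=
      (norm_diamond_le ι _ _).trans (mul_le_mul (norm_slice_le nE he hf u)
        (norm_slice_le nF he hg v) (norm_nonneg _) (apply_nonneg _ _))
    calc _ ≤ ‖b‖ * (‖d‖ * (nE.norm u * nF.norm v)) :=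
          (norm_cptMulLeft_le _ _).trans (mul_le_mul_of_nonneg_left
            ((norm_cptMulRight_le _ _).trans (mul_le_mul_of_nonneg_left h1 (norm_nonneg _)))
            (norm_nonneg _))
      _ = _ := by ring
  let q := (normSeminorm ℂ (Cpt L)).comp (slice (Cpt L) (prodFunctional f g))
  have h := le_mul_fourNorm (ι := ι) (nE := nE) (nF := nF) (q := q) hL q.map_zero'.le q.add_le'
    zero_le_one hterm U
  rwa [one_mul] at h

theorem eq_zero_of_fourNorm_eq_zero (hL : ¬ FiniteDimensional ℂ L) {U : Ampl L (E ⊗[ℂ] F)}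
    (hU : fourNorm ι nE nF U = 0) : U = 0 := by
  obtain ⟨e, he⟩ := exists_unit_vector hL
  refine (LinearEquiv.map_eq_zero_iff (TensorProduct.assoc ℂ (Cpt L) E F).symm).1 ?_
  refine eq_zero_of_forall_slice_eq_zero (nF.eq_zero_of_forall_functional he) fun g hg => ?_
  refine eq_zero_of_forall_slice_eq_zero (nE.eq_zero_of_forall_functional he) fun f hf => ?_
  rw [slice_slice_assoc, ← norm_le_zero_iff, ← hU]
  exact norm_slice_prodFunctional_le hL he hf hg U

end Functionals

/-! ### Contractivity of the extended diamond operation -/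

section Contractivity

open Filter Topology

variable {L : Type*} [NormedAddCommGroup L] [InnerProductSpace ℂ L]
variable {E : Type*} [AddCommGroup E] [Module ℂ E] {F : Type*} [AddCommGroup F] [Module ℂ F]

theorem tendsto_lact_ract {p : Seminorm ℂ (Ampl L E)} (hp : RuanOne p) {α : Type*} {l : Filter α}
    {f g : α → L →L[ℂ] L} {a b : L →L[ℂ] L} (hf : Tendsto f l (𝓝 a)) (hg : Tendsto g l (𝓝 b))
    (w : Ampl L E) :
    Tendsto (fun t => p (lact (f t) (ract (g t) w) - lact a (ract b w))) l (𝓝 0) := by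
  have h : Tendsto (fun t => ‖f t - a‖ * (‖g t‖ * p w) + ‖a‖ * (‖g t - b‖ * p w)) l
      (𝓝 (‖a - a‖ * (‖b‖ * p w) + ‖a‖ * (‖b - b‖ * p w))) :=
    ((hf.sub_const a).norm.mul (hg.norm.mul_const _)).add
      (((hg.sub_const b).norm.mul_const _).const_mul _)
  rw [sub_self, sub_self, norm_zero, zero_mul, zero_mul, mul_zero, add_zero] at h
  refine squeeze_zero (fun t => apply_nonneg p _) (fun t => ?_) h
  have hsplit : lact (f t) (ract (g t) w) - lact a (ract b w) =
      lact (f t - a) (ract (g t) w) + lact a (ract (g t - b) w) := by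
    rw [map_sub, map_sub, LinearMap.sub_apply, LinearMap.sub_apply, map_sub]
    abel
  rw [hsplit]
  refine (map_add_le_add p _ _).trans (add_le_add ?_ ?_)
  · exact (hp _ _).1.trans (mul_le_mul_of_nonneg_left (hp _ _).2 (norm_nonneg _))
  · exact (hp _ _).1.trans (mul_le_mul_of_nonneg_left (hp _ _).2 (norm_nonneg _))

variable [CompleteSpace L]

/-- Cutting `u ⋄ v` down by `P ⋄ P`, for finite rank projections `P` tending to `1`, recovers
`u ⋄ v` in the limit. A bound of `p (a x)` by the norm of `a` is not available at this point; writing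
the coefficients as `a = b c d` with compact factors reduces convergence for `p` to the norm
convergence `P b → b` and `d P → d`, by the first axiom of Ruan alone. -/
theorem tendsto_spanProj_extDiamond (hL : ¬ FiniteDimensional ℂ L)
    (ι : L ≃ₗᵢ[ℂ] HilbertTensor L L) {p : Seminorm ℂ (Ampl L (E ⊗[ℂ] F))} (hp : RuanOne p)
    (u : Ampl L E) (v : Ampl L F) :
    Tendsto (fun t => p (lact (diamond ι (spanProj t) (spanProj t))
      (ract (diamond ι (spanProj t) (spanProj t)) (extDiamond ι u v)) - extDiamond ι u v))
      atTop (𝓝 0) := by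
  have hadd : ∀ w w' : Ampl L (E ⊗[ℂ] F),
      Tendsto (fun t => p (lact (diamond ι (spanProj t) (spanProj t))
        (ract (diamond ι (spanProj t) (spanProj t)) w) - w)) atTop (𝓝 0) →
      Tendsto (fun t => p (lact (diamond ι (spanProj t) (spanProj t))
        (ract (diamond ι (spanProj t) (spanProj t)) w') - w')) atTop (𝓝 0) →
      Tendsto (fun t => p (lact (diamond ι (spanProj t) (spanProj t))
        (ract (diamond ι (spanProj t) (spanProj t)) (w + w')) - (w + w'))) atTop (𝓝 0) := by
    intro w w' h h'
    have h2 := h.add h'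
    rw [add_zero] at h2
    refine squeeze_zero (fun t => apply_nonneg p _) (fun t => ?_) h2
    rw [map_add, map_add, add_sub_add_comm]
    exact map_add_le_add p _ _
  have h0 : Tendsto (fun t => p (lact (diamond ι (spanProj t) (spanProj t))
      (ract (diamond ι (spanProj t) (spanProj t)) 0) - 0)) atTop (𝓝 0) := by
    refine tendsto_const_nhds.congr fun t => ?_
    rw [map_zero, map_zero, sub_zero]
    exact p.map_zero'.symm
  induction u using TensorProduct.induction_on with
  | zero => simpa only [map_zero, LinearMap.zero_apply] using h0
  | add u u' hu hu' => simpa only [map_add, LinearMap.add_apply] using hadd _ _ hu hu'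
  | tmul a x =>
    induction v using TensorProduct.induction_on with
    | zero => simpa only [map_zero] using h0
    | add v v' hv hv' => simpa only [map_add] using hadd _ _ hv hv'
    | tmul a' y =>
      obtain ⟨b, c, d, rfl⟩ := exists_eq_mul_mul_of_isCompactOperator hL ι a
      obtain ⟨b', c', d', rfl⟩ := exists_eq_mul_mul_of_isCompactOperator hL ι a'
      rw [← lact_tmul, ← lact_tmul, ← ract_tmul, ← ract_tmul, extDiamond_lact, extDiamond_ract]
      simp_rw [ract_lact, ract_ract, lact_lact, ← diamond_mul]
      exact tendsto_lact_ract hp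
        (tendsto_diamond ι (tendsto_spanProj_mul b.2) (tendsto_spanProj_mul b'.2))
        (tendsto_diamond ι (tendsto_mul_spanProj d.2) (tendsto_mul_spanProj d'.2)) _

variable {ι : L ≃ₗᵢ[ℂ] HilbertTensor L L} {nE : QuantumNorm L E} {nF : QuantumNorm L F}

/-- The canonical bilinear operator is weakly completely contractive. When `P` is a finite rank
projection, `P ⋄ P` is a compact contraction, hence an admissible outer factor. -/
theorem fourNorm_extDiamond_le (hL : ¬ FiniteDimensional ℂ L) (u : Ampl L E) (v : Ampl L F) :
    fourNorm ι nE nF (extDiamond ι u v) ≤ nE.norm u * nF.norm v := by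
  have hp := ruanOne_fourSeminorm (ι := ι) (nE := nE) (nF := nF) hL
  have h := (tendsto_spanProj_extDiamond hL ι hp u v).const_add (nE.norm u * nF.norm v)
  rw [add_zero] at h
  refine ge_of_tendsto' h fun t => ?_
  let ρ : Cpt L := ⟨diamond ι (spanProj t) (spanProj t), isCompactOperator_diamond ι
    ⟨spanProj t, isCompactOperator_spanProj t⟩ ⟨spanProj t, isCompactOperator_spanProj t⟩⟩
  have hρ : ‖ρ‖ ≤ 1 := (norm_diamond_le ι _ _).trans
    (mul_le_one₀ (norm_spanProj_le t) (norm_nonneg _) (norm_spanProj_le t))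
  have h1 : fourNorm ι nE nF (lact (ρ : L →L[ℂ] L) (ract (ρ : L →L[ℂ] L) (extDiamond ι u v))) ≤
      nE.norm u * nF.norm v := by
    refine (fourNorm_lact_ract_extDiamond_le hL ρ ρ u v).trans ?_
    have hu := apply_nonneg nE.norm u
    have hv := apply_nonneg nF.norm v
    calc _ ≤ 1 * nE.norm u * nF.norm v * 1 := by gcongr
      _ = _ := by ring
  have h2 := map_sub_le_add (fourSeminorm hL ι nE nF)
    (lact (ρ : L →L[ℂ] L) (ract (ρ : L →L[ℂ] L) (extDiamond ι u v)))
    (lact (ρ : L →L[ℂ] L) (ract (ρ : L →L[ℂ] L) (extDiamond ι u v)) - extDiamond ι u v)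
  rw [sub_sub_cancel] at h2
  exact h2.trans (add_le_add_left h1 _)

end Contractivity

/-! ### The universal property -/

section UniversalProperty

variable {L : Type*} [NormedAddCommGroup L] [InnerProductSpace ℂ L] [CompleteSpace L]
variable {E : Type*} [AddCommGroup E] [Module ℂ E] {F : Type*} [AddCommGroup F] [Module ℂ F]
  {G : Type*} [AddCommGroup G] [Module ℂ G]

/-- `‖·‖₄` as a quantum norm on `E ⊗ F`. -/
def fourQuantumNorm (hL : ¬ FiniteDimensional ℂ L) (ι : L ≃ₗᵢ[ℂ] HilbertTensor L L)
    (nE : QuantumNorm L E) (nF : QuantumNorm L F) : QuantumNorm L (E ⊗[ℂ] F) where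
  norm := fourSeminorm hL ι nE nF
  eq_zero_of_norm_eq_zero _ := eq_zero_of_fourNorm_eq_zero hL
  ruanOne := ruanOne_fourSeminorm hL
  ruanTwo := ruanTwo_fourSeminorm hL

variable {ι : L ≃ₗᵢ[ℂ] HilbertTensor L L} {nE : QuantumNorm L E} {nF : QuantumNorm L F}

/-- A constant bounds the amplification of the linearization `S` of `R` exactly when it bounds the
weak amplification of `R`. -/
theorem forall_amplify_le_iff (hL : ¬ FiniteDimensional ℂ L) (nG : QuantumNorm L G)
    {R : E →ₗ[ℂ] F →ₗ[ℂ] G} {S : E ⊗[ℂ] F →ₗ[ℂ] G} (h : ∀ x y, S (x ⊗ₜ y) = R x y) {C : ℝ}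
    (hC : 0 ≤ C) :
    (∀ U, nG.norm (amplify L S U) ≤ C * fourNorm ι nE nF U) ↔
      ∀ u v, nG.norm (weakAmplify ι R u v) ≤ C * nE.norm u * nF.norm v := by
  constructor
  · intro hS u v
    rw [← amplify_extDiamond ι S R h, mul_assoc]
    exact (hS _).trans (mul_le_mul_of_nonneg_left (fourNorm_extDiamond_le hL u v) hC)
  · intro hR U
    refine le_mul_fourNorm (q := fun U => nG.norm (amplify L S U)) hL
      (by rw [map_zero]; exact nG.norm_zero.le)
      (fun U V => by rw [map_add]; exact map_add_le_add _ _ _) hC (fun b d u v => ?_) U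
    rw [amplify_lact, amplify_ract, amplify_extDiamond ι S R h]
    calc _ ≤ ‖(b : L →L[ℂ] L)‖ * (‖(d : L →L[ℂ] L)‖ * (C * nE.norm u * nF.norm v)) :=
          (nG.ruanOne _ _).1.trans (mul_le_mul_of_nonneg_left
            ((nG.ruanOne _ _).2.trans (mul_le_mul_of_nonneg_left (hR u v) (norm_nonneg _)))
            (norm_nonneg _))
      _ = ‖b‖ * (‖d‖ * (C * nE.norm u * nF.norm v)) := rfl
      _ = _ := by ring

theorem fourNorm_universal (hL : ¬ FiniteDimensional ℂ L) (nG : QuantumNorm L G)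
    (R : E →ₗ[ℂ] F →ₗ[ℂ] G) (hR : IsWeaklyCompletelyBounded ι nE nF nG R) :
    ∃ S : (E ⊗[ℂ] F) →ₗ[ℂ] G,
      (IsCompletelyBounded (fourQuantumNorm hL ι nE nF) nG S ∧ ∀ x y, S (x ⊗ₜ[ℂ] y) = R x y) ∧
      cbNorm (fourQuantumNorm hL ι nE nF) nG S = wcbNorm ι nE nF nG R ∧
      ∀ S' : (E ⊗[ℂ] F) →ₗ[ℂ] G,
        IsCompletelyBounded (fourQuantumNorm hL ι nE nF) nG S' ∧
          (∀ x y, S' (x ⊗ₜ[ℂ] y) = R x y) → S' = S := by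
  have hlift : ∀ x y, TensorProduct.lift R (x ⊗ₜ[ℂ] y) = R x y := fun x y => rfl
  refine ⟨TensorProduct.lift R, ⟨?_, hlift⟩, ?_, fun S' hS' => TensorProduct.ext' hS'.2⟩
  · obtain ⟨C, hC⟩ := hR
    -- The constant in the definition of complete boundedness may be negative.
    refine ⟨max C 0, (forall_amplify_le_iff hL nG hlift (le_max_right C 0)).2 fun u v => ?_⟩
    refine (hC u v).trans ?_
    rw [mul_assoc, mul_assoc]
    exact mul_le_mul_of_nonneg_right (le_max_left C 0)
      (mul_nonneg (apply_nonneg _ _) (apply_nonneg _ _))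
  · refine congrArg sInf (Set.ext fun C => and_congr_right fun hC => ?_)
    exact forall_amplify_le_iff hL nG hlift hC

theorem isWeaklyCompletelyContractive_mk (hL : ¬ FiniteDimensional ℂ L) :
    IsWeaklyCompletelyContractive ι nE nF (fourQuantumNorm hL ι nE nF) (TensorProduct.mk ℂ E F) :=
  fourNorm_extDiamond_le hL

theorem fourNorm_universal_contractive (hL : ¬ FiniteDimensional ℂ L) (nG : QuantumNorm L G)
    (R : E →ₗ[ℂ] F →ₗ[ℂ] G) (hR : IsWeaklyCompletelyContractive ι nE nF nG R) :
    ∃! S : E ⊗[ℂ] F →ₗ[ℂ] G, IsCompletelyContractive (fourQuantumNorm hL ι nE nF) nG S ∧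
      ∀ x y, S (TensorProduct.mk ℂ E F x y) = R x y := by
  have hlift : ∀ x y, TensorProduct.lift R (x ⊗ₜ[ℂ] y) = R x y := fun x y => rfl
  refine ⟨TensorProduct.lift R, ⟨fun U => ?_, hlift⟩, fun S' hS' => TensorProduct.ext' hS'.2⟩
  have h := (forall_amplify_le_iff (ι := ι) (nE := nE) (nF := nF) hL nG hlift zero_le_one).2
    (fun u v => by rw [one_mul]; exact hR u v) U
  rwa [one_mul] at h

end UniversalProperty

end QuantumTensor

end

theorem theorem4 {L : Type u} [NormedAddCommGroup L] [InnerProductSpace ℂ L]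
    [CompleteSpace L] [TopologicalSpace.SeparableSpace L] (hL : ¬ FiniteDimensional ℂ L)
    (ι : L ≃ₗᵢ[ℂ] QuantumTensor.HilbertTensor L L)
    {E : Type v₁} [AddCommGroup E] [Module ℂ E] (nE : QuantumTensor.QuantumNorm L E)
    {F : Type v₂} [AddCommGroup F] [Module ℂ F] (nF : QuantumTensor.QuantumNorm L F) :
    -- the operator `b ⊗ u ⊗ v ⊗ d ↦ b · (u ⋄ v) · d` is surjective
    Function.Surjective (QuantumTensor.riggedDiamond ι E F) ∧
    -- the four-named seminorm is the infimum over representations by sums of such elements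
    (∀ U : QuantumTensor.Ampl L (E ⊗[ℂ] F),
      IsGLB {r : ℝ | ∃ (n : ℕ) (b d : Fin n → QuantumTensor.Cpt L)
        (u : Fin n → QuantumTensor.Ampl L E) (v : Fin n → QuantumTensor.Ampl L F),
        U = ∑ k, QuantumTensor.lact (b k : L →L[ℂ] L)
          (QuantumTensor.ract (d k : L →L[ℂ] L) (QuantumTensor.extDiamond ι (u k) (v k))) ∧
        r = ∑ k, ‖b k‖ * nE.norm (u k) * nF.norm (v k) * ‖d k‖}
        (QuantumTensor.fourNorm ι nE nF U)) ∧
    -- the four-named seminorm is a quantum norm `n₄` on `E ⊗ F`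
    ∃ n₄ : QuantumTensor.QuantumNorm L (E ⊗[ℂ] F),
      (∀ U, n₄.norm U = QuantumTensor.fourNorm ι nE nF U) ∧
      -- universal property for weakly completely bounded bilinear operators, with equal norms
      (∀ (G : Type w) [AddCommGroup G] [Module ℂ G] (nG : QuantumTensor.QuantumNorm L G)
        (R : E →ₗ[ℂ] F →ₗ[ℂ] G), QuantumTensor.IsWeaklyCompletelyBounded ι nE nF nG R →
        ∃ S : (E ⊗[ℂ] F) →ₗ[ℂ] G,
          (QuantumTensor.IsCompletelyBounded n₄ nG S ∧ ∀ x y, S (x ⊗ₜ[ℂ] y) = R x y) ∧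
          QuantumTensor.cbNorm n₄ nG S = QuantumTensor.wcbNorm ι nE nF nG R ∧
          ∀ S' : (E ⊗[ℂ] F) →ₗ[ℂ] G,
            QuantumTensor.IsCompletelyBounded n₄ nG S' ∧ (∀ x y, S' (x ⊗ₜ[ℂ] y) = R x y) →
            S' = S) ∧
      -- `(E ⊗₄ F, ϑ)` is the four-named tensor product of `E` and `F`
      QuantumTensor.IsFourNamedTensorProduct.{u, v₁, v₂, max v₁ v₂, w} ι nE nF n₄ (TensorProduct.mk ℂ E F) := by
  exact ⟨QuantumTensor.riggedDiamond_surjective hL ι, QuantumTensor.isGLB_fourNorm hL,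
    QuantumTensor.fourQuantumNorm hL ι nE nF, fun _ => rfl,
    fun _ _ _ nG R hR => QuantumTensor.fourNorm_universal hL nG R hR,
    QuantumTensor.isWeaklyCompletelyContractive_mk hL,
    fun _ _ _ nG R hR => QuantumTensor.fourNorm_universal_contractive hL nG R hR⟩
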